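/- Let $\theta_1,\theta_2\in[0,2\pi)\setminus\{0,\pi/2,\pi,3\pi/2\}$, $c_j=\cos\theta_j$, $s_j=\sin\theta_j$, and let $q_0,q_1,q_2,q_3\in\mathbb C$ satisfy $\sum_i|q_i|^2=1$. Consider the quantum walk on $\mathbb Z$ with coin states $|00\rangle,|01\rangle,|10\rangle,|11\rangle$ (where $|j_1j_2\rangle=|j_1\rangle\otimes|j_2\rangle$), whose state at time $t$ is $|\Psi_t\rangle=(SYSX)^t|\Psi_0\rangle$ with $$|\Psi_0\rangle=|0\rangle\otimes(q_0|00\rangle+q_1|01\rangle+q_2|10\rangle+q_3|11\rangle),$$ $$X=\sum_x|x\rangle\langle x|\otimes(U_2\otimes U_1),\qquad Y=\sum_x|x\rangle\langle x|\otimes(U_1\otimes U_2),\qquad U_j=\begin{pmatrix}c_j&s_j\\ s_j&-c_j\end{pmatrix},$$ and $S$ the shift that moves $|x\rangle\otimes|00\rangle$ to $|x-1\rangle\otimes|00\rangle$, moves $|x\rangle\otimes|11\rangle$ to $|x+1\rangle\otimes|11\rangle$, and fixes $|x\rangle\otimes|01\rangle$ and $|x\rangle\otimes|10\rangle$. Let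 $X_t$ be the position at time $t$, so that $\mathbb P(X_t=x)=\langle\Psi_t|(|x\rangle\langle x|\otimes 1)|\Psi_t\rangle$. Put $\nu_1=\frac{(1+s_1)(1-s_2)}{c_1c_2}$, $\nu_2=-\frac{(1+s_1)(1+s_2)}{c_1c_2}$, let $I(P)$ be $1$ if $P$ holds and $0$ otherwise, and for integers $x$ put $$\eta_1(x)=-\tfrac14\Bigl[(s_1-s_2)\bigl\{\nu_1^{|x|}I(s_1<s_2)-\nu_1^{-|x|}I(s_1>s_2)\bigr\}+(s_1+s_2)\bigl\{\nu_2^{|x|}I(s_1<-s_2)-\nu_2^{-|x|}I(s_1>-s_2)\bigr\}\Bigr],$$ for $x\ge0$ $$\eta_2(x)=\tfrac14\Bigl[(s_1-s_2)\bigl\{\nu_2\nu_1^{x}I(s_1<s_2)-\nu_2^{-1}\nu_1^{-x}I(s_1>s_2)\bigr\}+(s_1+s_2)\bigl\{\nu_1\nu_2^{x}I(s_1<-s_2)-\nu_1^{-1}\nu_2^{-x}I(s_1>-s_2)\bigr\}\Bigr],$$ $$\eta_3(x)=\tfrac{c_1}4\Bigl[(s_1-s_2)\bigl\{\tfrac{\nu_1^{x}}{1-s_1}I(s_1<s_2)+\tfrac{\nu_1^{-x}}{1+s_1}I(s_1>s_2)\bigr\}+(s_1+s_2)\bigl\{\tfrac{\nu_2^{x}}{1-s_1}I(s_1<-s_2)+\tfrac{\nu_2^{-x}}{1+s_1}I(s_1>-s_2)\bigr\}\Bigr],$$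 and for $x<0$ $$\eta_3(x)=-\tfrac{c_1}4\Bigl[(s_1-s_2)\bigl\{\tfrac{\nu_1^{-x}}{1+s_1}I(s_1<s_2)+\tfrac{\nu_1^{x}}{1-s_1}I(s_1>s_2)\bigr\}+(s_1+s_2)\bigl\{\tfrac{\nu_2^{-x}}{1+s_1}I(s_1<-s_2)+\tfrac{\nu_2^{x}}{1-s_1}I(s_1>-s_2)\bigr\}\Bigr].$$ Let $\{m,M\}=\{1,2\}$ with $|c_m|=\min\{|c_1|,|c_2|\}$ and $|c_M|=\max\{|c_1|,|c_2|\}$, and put $$\begin{aligned}\Delta={}&|q_1|^2+|q_2|^2+\bigl(|q_0|^2-|q_1|^2-|q_2|^2+|q_3|^2\bigr)\eta_1(0)-2\bigl\{\Re(q_0\overline{q_3})\eta_1(1)-\Re(q_1\overline{q_2})\eta_2(0)\\&+\Re(q_0\overline{q_1}-q_2\overline{q_3})\eta_3(0)+\Re(q_0\overline{q_2}-q_1\overline{q_3})\eta_3(-1)\bigr\},\end{aligned}$$ $$d_0=2\Bigl\{1+\tfrac{2c_m^2s_M}{c_1c_2s_m}\Re(q_1\overline{q_2}-q_0\overline{q_3})\Bigr\},$$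 $$d_1=-2\Bigl\{|q_0|^2-|q_3|^2+\tfrac{s_1}{c_1}\Re(q_0\overline{q_1}+q_2\overline{q_3})+\tfrac{s_2}{c_2}\Re(q_0\overline{q_2}+q_1\overline{q_3})\Bigr\},$$ $$\begin{aligned}d_2={}&\tfrac12\bigl(|q_0|^2-|q_1|^2-|q_2|^2+|q_3|^2\bigr)+\tfrac{s_1}{c_1}\Re(q_0\overline{q_1}-q_2\overline{q_3})+\tfrac{s_2}{c_2}\Re(q_0\overline{q_2}-q_1\overline{q_3})\\&+\tfrac{s_1s_2}{c_1c_2}\Re(q_0\overline{q_3}+q_1\overline{q_2})+\tfrac{s_M}{c_1c_2s_m}\Re(q_0\overline{q_3}-q_1\overline{q_2}),\end{aligned}$$ $$f(y)=\frac{|s_m|(d_0+d_1y+d_2y^2)}{\pi(4-y^2)\sqrt{4c_m^2-y^2}}\ \text{ for } |y|<2|c_m|,\qquad f(y)=0\ \text{ otherwise.}$$ Then $\Delta\ge0$, $f\ge0$, $f$ is integrable and $\Delta+\int_{\mathbb R}f(y)\,dy=1$, so that $\Delta\,\delta_0+f(y)\,dy$ is a probability law, and $X_t/t$ converges in distribution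 to it: for every real $x\ne0$, $$\lim_{t\to\infty}\mathbb P\Bigl(\frac{X_t}{t}\le x\Bigr)=\Delta\,I(x\ge0)+\int_{-\infty}^x f(y)\,dy.$$ -/

import Mathlib

open Filter Topology MeasureTheory
open scoped Kronecker

noncomputable section

namespace QWalk

/-- Wave functions of the walker: `ψ x (j₁, j₂)` is the coefficient of `|x⟩ ⊗ |j₁j₂⟩`. -/
abbrev Wave : Type := ℤ → Fin 2 × Fin 2 → ℂ

/-- The coin `cos θ |0⟩⟨0| + sin θ |0⟩⟨1| + sin θ |1⟩⟨0| - cos θ |1⟩⟨1|`. -/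
def coin (θ : ℝ) : Matrix (Fin 2) (Fin 2) ℂ :=
  !![(Real.cos θ : ℂ), (Real.sin θ : ℂ); (Real.sin θ : ℂ), -(Real.cos θ : ℂ)]

/-- The coin flip `∑ₓ |x⟩⟨x| ⊗ A` with a `4 × 4` matrix `A`. -/
def flip (A : Matrix (Fin 2 × Fin 2) (Fin 2 × Fin 2) ℂ) (ψ : Wave) : Wave :=
  fun x => A.mulVec (ψ x)

/-- The displacement in each coin state: `|00⟩` goes left, `|11⟩` goes right,
`|01⟩` and `|10⟩` stay. -/
def displacement (j : Fin 2 × Fin 2) : ℤ :=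
  if j = (0, 0) then -1 else if j = (1, 1) then 1 else 0

/-- The position shift `S`, which sends `|x⟩ ⊗ |j⟩` to `|x + displacement j⟩ ⊗ |j⟩`. -/
def shift (ψ : Wave) : Wave := fun x j => ψ (x - displacement j) j

/-- One time step `S Y S X`, with `X` built from `U₂ ⊗ U₁` and `Y` from `U₁ ⊗ U₂`.
Here `U₁ = coin (θ 0)` and `U₂ = coin (θ 1)`. -/
def step (θ : Fin 2 → ℝ) (ψ : Wave) : Wave :=
  shift (flip (coin (θ 0) ⊗ₖ coin (θ 1)) (shift (flip (coin (θ 1) ⊗ₖ coin (θ 0)) ψ)))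

/-- The initial state `|0⟩ ⊗ (q₀|00⟩ + q₁|01⟩ + q₂|10⟩ + q₃|11⟩)`. -/
def initial (q : Fin 4 → ℂ) : Wave :=
  fun x j => if x = 0 then !![q 0, q 1; q 2, q 3] j.1 j.2 else 0

/-- The state `Ψ_t = (S Y S X)^t Ψ_0`. -/
def state (θ : Fin 2 → ℝ) (q : Fin 4 → ℂ) (t : ℕ) : Wave := (step θ)^[t] (initial q)

/-- The weight `⟨ψ| (|x⟩⟨x| ⊗ 1) |ψ⟩` of position `x`. -/
def weight (ψ : Wave) (x : ℤ) : ℝ := ∑ j, ‖ψ x j‖ ^ 2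

lemma weight_flip (a b : ℝ) (ψ : Wave) (x : ℤ) :
    weight (flip (coin a ⊗ₖ coin b) ψ) x = weight ψ x := by
  have ha := Real.sin_sq_add_cos_sq a
  have hb := Real.sin_sq_add_cos_sq b
  simp only [weight, flip, Matrix.mulVec, dotProduct, Fintype.sum_prod_type, Fin.sum_univ_two,
    Matrix.kroneckerMap_apply, coin, Matrix.of_apply, Matrix.cons_val', Matrix.cons_val_zero,
    Matrix.cons_val_one, Matrix.cons_val_fin_one, ← Complex.normSq_eq_norm_sq,
    Complex.normSq_apply, Complex.add_re, Complex.add_im, Complex.mul_re, Complex.mul_im,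
    Complex.neg_re, Complex.neg_im, Complex.ofReal_re, Complex.ofReal_im]
  generalize Real.sin a = sa at *
  generalize Real.cos a = ca at *
  generalize Real.sin b = sb at *
  generalize Real.cos b = cb at *
  have h1 : sa ^ 2 = 1 - ca ^ 2 := by linarith
  have h2 : sb ^ 2 = 1 - cb ^ 2 := by linarith
  ring_nf
  simp only [h1, h2]
  ring

lemma tsum_weight_flip (a b : ℝ) (ψ : Wave) :
    ∑' x, ENNReal.ofReal (weight (flip (coin a ⊗ₖ coin b) ψ) x)
      = ∑' x, ENNReal.ofReal (weight ψ x) := by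
  simp only [weight_flip]

lemma tsum_weight_eq (ψ : Wave) :
    ∑' x, ENNReal.ofReal (weight ψ x) = ∑ j, ∑' x, ENNReal.ofReal (‖ψ x j‖ ^ 2) := by
  simp only [weight]
  rw [← Summable.tsum_finsetSum fun _ _ => ENNReal.summable]
  exact tsum_congr fun x => ENNReal.ofReal_sum_of_nonneg fun j _ => by positivity

lemma tsum_weight_shift (ψ : Wave) :
    ∑' x, ENNReal.ofReal (weight (shift ψ) x) = ∑' x, ENNReal.ofReal (weight ψ x) := by
  rw [tsum_weight_eq, tsum_weight_eq]
  refine Finset.sum_congr rfl fun j _ => ?_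
  exact (Equiv.subRight (displacement j)).tsum_eq (fun x => ENNReal.ofReal (‖ψ x j‖ ^ 2))

lemma tsum_weight_state (θ : Fin 2 → ℝ) (q : Fin 4 → ℂ) (hq : ∑ i, ‖q i‖ ^ 2 = 1) (t : ℕ) :
    ∑' x, ENNReal.ofReal (weight (state θ q t) x) = 1 := by
  induction t with
  | zero =>
    rw [tsum_eq_single 0]
    · have h : weight (state θ q 0) 0 = ∑ i, ‖q i‖ ^ 2 := by
        simp [weight, state, initial, Fintype.sum_prod_type, Fin.sum_univ_four]
        ring
      rw [h, hq, ENNReal.ofReal_one]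
    · intro x hx
      simp [weight, state, initial, hx]
  | succ t ih =>
    rw [state, Function.iterate_succ_apply', step, tsum_weight_shift, tsum_weight_flip,
      tsum_weight_shift, tsum_weight_flip]
    exact ih

/-- The law of the position `X_t`: `P(X_t = x) = ⟨Ψ_t| (|x⟩⟨x| ⊗ 1) |Ψ_t⟩`. -/
def positionLaw (θ : Fin 2 → ℝ) (q : Fin 4 → ℂ) (hq : ∑ i, ‖q i‖ ^ 2 = 1) (t : ℕ) : PMF ℤ :=
  ⟨fun x => ENNReal.ofReal (weight (state θ q t) x),
    tsum_weight_state θ q hq t ▸ ENNReal.summable.hasSum⟩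

/-- The distribution function `P(X_t / t ≤ x)`. -/
def rescaledCDF (θ : Fin 2 → ℝ) (q : Fin 4 → ℂ) (hq : ∑ i, ‖q i‖ ^ 2 = 1) (t : ℕ) (x : ℝ) : ℝ :=
  (positionLaw θ q hq t).toMeasure.real {n : ℤ | (n : ℝ) / (t : ℝ) ≤ x}

/-- `c i = cos (θ i)`; the indices `0, 1` stand for the subscripts `1, 2`. -/
def c (θ : Fin 2 → ℝ) (i : Fin 2) : ℝ := Real.cos (θ i)

/-- `s i = sin (θ i)`. -/
def s (θ : Fin 2 → ℝ) (i : Fin 2) : ℝ := Real.sin (θ i)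

/-- The indicator `I(P)` of a proposition. -/
def ind (P : Prop) [Decidable P] : ℝ := if P then 1 else 0

def ν₁ (θ : Fin 2 → ℝ) : ℝ := (1 + s θ 0) * (1 - s θ 1) / (c θ 0 * c θ 1)

def ν₂ (θ : Fin 2 → ℝ) : ℝ := -((1 + s θ 0) * (1 + s θ 1) / (c θ 0 * c θ 1))

def η₁ (θ : Fin 2 → ℝ) (x : ℤ) : ℝ :=
  -(1 / 4) *
    ((s θ 0 - s θ 1) *
        (ν₁ θ ^ |x| * ind (s θ 0 < s θ 1) - ν₁ θ ^ (-|x|) * ind (s θ 0 > s θ 1))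
      + (s θ 0 + s θ 1) *
        (ν₂ θ ^ |x| * ind (s θ 0 < -s θ 1) - ν₂ θ ^ (-|x|) * ind (s θ 0 > -s θ 1)))

def η₂ (θ : Fin 2 → ℝ) (x : ℤ) : ℝ :=
  if 0 ≤ x then
    (1 / 4) *
      ((s θ 0 - s θ 1) *
          (ν₂ θ * ν₁ θ ^ x * ind (s θ 0 < s θ 1)
            - (ν₂ θ)⁻¹ * ν₁ θ ^ (-x) * ind (s θ 0 > s θ 1))
        + (s θ 0 + s θ 1) *
          (ν₁ θ * ν₂ θ ^ x * ind (s θ 0 < -s θ 1)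
            - (ν₁ θ)⁻¹ * ν₂ θ ^ (-x) * ind (s θ 0 > -s θ 1)))
  else
    (1 / 4) *
      ((s θ 0 - s θ 1) *
          ((ν₂ θ)⁻¹ * ν₁ θ ^ (-x) * ind (s θ 0 < s θ 1)
            - ν₂ θ * ν₁ θ ^ x * ind (s θ 0 > s θ 1))
        + (s θ 0 + s θ 1) *
          ((ν₁ θ)⁻¹ * ν₂ θ ^ (-x) * ind (s θ 0 < -s θ 1)
            - ν₁ θ * ν₂ θ ^ x * ind (s θ 0 > -s θ 1)))

def η₃ (θ : Fin 2 → ℝ) (x : ℤ) : ℝ :=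
  if 0 ≤ x then
    (c θ 0 / 4) *
      ((s θ 0 - s θ 1) *
          (1 / (1 - s θ 0) * ν₁ θ ^ x * ind (s θ 0 < s θ 1)
            + 1 / (1 + s θ 0) * ν₁ θ ^ (-x) * ind (s θ 0 > s θ 1))
        + (s θ 0 + s θ 1) *
          (1 / (1 - s θ 0) * ν₂ θ ^ x * ind (s θ 0 < -s θ 1)
            + 1 / (1 + s θ 0) * ν₂ θ ^ (-x) * ind (s θ 0 > -s θ 1)))
  else
    -(c θ 0 / 4) *
      ((s θ 0 - s θ 1) *
          (1 / (1 + s θ 0) * ν₁ θ ^ (-x) * ind (s θ 0 < s θ 1)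
            + 1 / (1 - s θ 0) * ν₁ θ ^ x * ind (s θ 0 > s θ 1))
        + (s θ 0 + s θ 1) *
          (1 / (1 + s θ 0) * ν₂ θ ^ (-x) * ind (s θ 0 < -s θ 1)
            + 1 / (1 - s θ 0) * ν₂ θ ^ x * ind (s θ 0 > -s θ 1)))

/-- `cr q i j = Re (q i * conj (q j))`. -/
def cr (q : Fin 4 → ℂ) (i j : Fin 4) : ℝ := (q i * (starRingEnd ℂ) (q j)).re

/-- The mass `Δ` of the atom at the origin. -/
def atomMass (θ : Fin 2 → ℝ) (q : Fin 4 → ℂ) : ℝ :=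
  ‖q 1‖ ^ 2 + ‖q 2‖ ^ 2
    + (‖q 0‖ ^ 2 - ‖q 1‖ ^ 2 - ‖q 2‖ ^ 2 + ‖q 3‖ ^ 2) * η₁ θ 0
    - 2 * (cr q 0 3 * η₁ θ 1 - cr q 1 2 * η₂ θ 0
        + (cr q 0 1 - cr q 2 3) * η₃ θ 0 + (cr q 0 2 - cr q 1 3) * η₃ θ (-1))

def d₀ (θ : Fin 2 → ℝ) (q : Fin 4 → ℂ) (m M : Fin 2) : ℝ :=
  2 * (1 + 2 * c θ m ^ 2 * s θ M / (c θ 0 * c θ 1 * s θ m) * (cr q 1 2 - cr q 0 3))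

def d₁ (θ : Fin 2 → ℝ) (q : Fin 4 → ℂ) : ℝ :=
  -2 * (‖q 0‖ ^ 2 - ‖q 3‖ ^ 2 + s θ 0 / c θ 0 * (cr q 0 1 + cr q 2 3)
    + s θ 1 / c θ 1 * (cr q 0 2 + cr q 1 3))

def d₂ (θ : Fin 2 → ℝ) (q : Fin 4 → ℂ) (m M : Fin 2) : ℝ :=
  1 / 2 * (‖q 0‖ ^ 2 - ‖q 1‖ ^ 2 - ‖q 2‖ ^ 2 + ‖q 3‖ ^ 2)
    + s θ 0 / c θ 0 * (cr q 0 1 - cr q 2 3) + s θ 1 / c θ 1 * (cr q 0 2 - cr q 1 3)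
    + s θ 0 * s θ 1 / (c θ 0 * c θ 1) * (cr q 0 3 + cr q 1 2)
    + s θ M / (c θ 0 * c θ 1 * s θ m) * (cr q 0 3 - cr q 1 2)

/-- The density of the absolutely continuous part, zero outside `(-2|c_m|, 2|c_m|)`. -/
def density (θ : Fin 2 → ℝ) (q : Fin 4 → ℂ) (m M : Fin 2) : ℝ → ℝ :=
  (Set.Ioo (-2 * |c θ m|) (2 * |c θ m|)).indicator fun y =>
    |s θ m| * (d₀ θ q m M + d₁ θ q * y + d₂ θ q m M * y ^ 2)
      / (Real.pi * (4 - y ^ 2) * Real.sqrt (4 * c θ m ^ 2 - y ^ 2))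

end QWalk

end

/-!
The Fourier transform in the position turns one time step into multiplication by `A(k) ⊗ B(k)`,
where `A = R U₁ R U₂` and `B = R U₂ R U₁` with `R = diag(e^{ik/2}, e^{-ik/2})` lie in `SU(2)` and
have the same eigenvalues `e^{±iω(k)}`, `cos ω = c₁ c₂ cos k + s₁ s₂`. So `A = cos ω + i sin ω N`
and `B = cos ω + i sin ω N'` with traceless Hermitian involutions `N, N'`, whose diagonal entries
are `±v` with `v = dω/dk` the same for both (`walkSymbol_eq`).

*Limit of the characteristic functions.* The characteristic function of `X_t / t` at `ξ` is an
average over `k` of `⟨(A(k) ⊗ B(k))^t q, (A(k - ξ/t) ⊗ B(k - ξ/t))^t q⟩`. No stationary phase is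
needed: `A(k)^{-t} A(k - ξ/t)^t` converges pointwise to `cos (ξ v) - i sin (ξ v) N`
(`tendsto_walkSymbol_pow`), and unitarity gives domination. Since the two factors rotate with the
same velocity, the product of the limits contains `cos² (ξ v)` and `sin² (ξ v)`, hence a part that
does not depend on `ξ`: this is the atom at the origin. After folding `k` with `-k`, what remains
(`tensorForm_phaseMatrix_fold`) is `1 - Q + cos (2 ξ v) (1 + Q) + i d₁ v sin (2 ξ v)`, where
`Q = corr θ q` is the even part of `⟨N ⊗ N'⟩`, a combination of `v²` and of the product `w` of the
imaginary parts of the off-diagonal entries of `N` and `N'` (`corr`).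

*From `k` to the velocity.* The relation defining `ω` is the cosine rule in a spherical triangle
with sides `π/2 - θ₁` and `π/2 - θ₂` enclosing the angle `k`. If `φ` and `φ'` are the complements
of the other two angles (`ang`), the sine rule gives `v = ± cos θ₁ cos φ = ± cos θ₂ cos φ'`, and
`1 - v²`, `w (1 - v²)` and `c₁ c₂ w + s₁ s₂` are combinations of `dφ/dk` and `dφ'/dk` with
coefficients depending on `v` only (`one_sub_vel_sq`, `wprod_mul_one_sub_vel_sq`, `wprod_add`). So
the averages of even functions of `v` become integrals over the ranges of `φ` and `φ'`
(`integral_mul_dang`). Only the angle attached to the smaller `|cos θ_m|` runs over a full half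
turn, the other one returns to its starting value (`winding_of_lt`; if `|cos θ₁| = |cos θ₂|`, each
runs over a quarter turn); this is why the density depends on `c_m` and on `s_M / s_m`. The
substitution `y = 2 c_m cos φ` then yields the factor `1 / √(4 c_m² - y²)` (`integral_arcsine`),
and the integral of `1 - Q` yields the mass of the atom in closed form (`integral_one_sub_corr`,
`atomMass_eq`).

*Positivity.* `1 ± N` and `1 ± N'` are positive semidefinite, hence so are their Kronecker
products, which gives `Q ≤ 1` and so `Δ ≥ 0`. The numerator of `f` has the same shape, with `w`
replaced by its average `s_M (c_m² - v²) / (c₁ c₂ s_m)`; this is again a product of imaginary parts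
for which the matrices are positive semidefinite (`exists_imaginary_parts`), so `f ≥ 0`.

At `ξ = 0` the limit gives total mass `1`, and Lévy's continuity theorem together with the
portmanteau theorem gives convergence of the distribution functions at every `x ≠ 0`, the origin
being the only atom of the limit law.
-/

noncomputable section

namespace QWalk

/-! ### The Fourier transform of the walk -/

section

open Complex ComplexConjugate

/-- `F k j` is the sum of the Fourier series `∑ₓ e^{-ikx} ψ x j` of the wave function `ψ`, for
every `k` and `j`. -/
def IsFourier (ψ : Wave) (F : ℝ → Fin 2 × Fin 2 → ℂ) : Prop :=
  ∀ (k : ℝ) j, HasSum (fun x : ℤ => exp (-((k : ℂ) * x * I)) * ψ x j) (F k j)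

lemma IsFourier.flip {ψ : Wave} {F : ℝ → Fin 2 × Fin 2 → ℂ} (h : IsFourier ψ F)
    (A : Matrix (Fin 2 × Fin 2) (Fin 2 × Fin 2) ℂ) :
    IsFourier (flip A ψ) fun k => A.mulVec (F k) := by
  intro k j
  have h1 := hasSum_sum fun (i : Fin 2 × Fin 2) (_ : i ∈ Finset.univ) => (h k i).mul_left (A j i)
  refine Eq.mp (congrArg (fun f => HasSum f _) (funext fun x => ?_)) h1
  symm
  simp only [QWalk.flip, Matrix.mulVec, dotProduct, Finset.mul_sum]
  exact Finset.sum_congr rfl fun i _ => by ring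

/-- The multiplier `diag(e^{ik/2}, e^{-ik/2})`; its Kronecker square is the symbol of the shift. -/
def halfShift (k : ℝ) : Matrix (Fin 2) (Fin 2) ℂ :=
  Matrix.diagonal ![exp (k / 2 * I), exp (-(k / 2 * I))]

lemma halfShift_kronecker (k : ℝ) :
    halfShift k ⊗ₖ halfShift k
      = Matrix.diagonal fun j => exp (-(k * displacement j * I)) := by
  rw [halfShift, Matrix.diagonal_kronecker_diagonal]
  congr 1
  funext ⟨i, j⟩
  fin_cases i <;> fin_cases j <;> simp [displacement, ← Complex.exp_add] <;> ring_nf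

lemma IsFourier.shift {ψ : Wave} {F : ℝ → Fin 2 × Fin 2 → ℂ} (h : IsFourier ψ F) :
    IsFourier (shift ψ) fun k => (halfShift k ⊗ₖ halfShift k).mulVec (F k) := by
  intro k j
  simp only [halfShift_kronecker, Matrix.mulVec_diagonal]
  have h1 := (h k j).mul_left (exp (-(k * displacement j * I)))
  rw [← (Equiv.subRight (displacement j)).hasSum_iff] at h1
  refine Eq.mp (congrArg (fun f => HasSum f _) (funext fun x => ?_)) h1
  symm
  simp only [QWalk.shift, Function.comp_apply, Equiv.subRight_apply, ← mul_assoc, ← Complex.exp_add]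
  push_cast
  ring_nf

/-- The symbol of one time step is `walkSymbol a b k ⊗ₖ walkSymbol b a k`. -/
def walkSymbol (a b k : ℝ) : Matrix (Fin 2) (Fin 2) ℂ :=
  halfShift k * coin a * (halfShift k * coin b)

/-- The amplitudes of the initial coin state. -/
def amp (q : Fin 4 → ℂ) : Fin 2 × Fin 2 → ℂ := fun j => !![q 0, q 1; q 2, q 3] j.1 j.2

lemma isFourier_state (θ : Fin 2 → ℝ) (q : Fin 4 → ℂ) (t : ℕ) :
    IsFourier (state θ q t) fun k =>
      ((walkSymbol (θ 0) (θ 1) k ^ t) ⊗ₖ (walkSymbol (θ 1) (θ 0) k ^ t)).mulVec (amp q) := by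
  induction t with
  | zero =>
    intro k j
    have := hasSum_single (f := fun x : ℤ => exp (-(k * x * I)) * state θ q 0 x j) 0
      (fun x hx => by simp [state, initial, hx])
    simpa [state, initial, amp] using this
  | succ t ih =>
    have h := (((ih.flip (coin (θ 1) ⊗ₖ coin (θ 0))).shift).flip
      (coin (θ 0) ⊗ₖ coin (θ 1))).shift
    rw [state, Function.iterate_succ_apply', step]
    refine (congrArg (IsFourier _) (funext fun k => ?_)).mp h
    simp only [Matrix.mulVec_mulVec, ← Matrix.mul_kronecker_mul, pow_succ', walkSymbol]
    simp only [Matrix.mul_assoc]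

/-- Each step moves the walker by at most two sites. -/
lemma state_eq_zero (θ : Fin 2 → ℝ) (q : Fin 4 → ℂ) (t : ℕ) (x : ℤ) (hx : 2 * (t : ℤ) < |x|) :
    state θ q t x = 0 := by
  have hflip : ∀ (A : Matrix (Fin 2 × Fin 2) (Fin 2 × Fin 2) ℂ) (ψ : Wave) (N : ℤ),
      (∀ x, N < |x| → ψ x = 0) → ∀ x, N < |x| → flip A ψ x = 0 := by
    intro A ψ N h x hx
    simp [flip, h x hx]
  have hshift : ∀ (ψ : Wave) (N : ℤ),
      (∀ x, N < |x| → ψ x = 0) → ∀ x, N + 1 < |x| → shift ψ x = 0 := by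
    intro ψ N h x hx
    funext j
    have hd : |displacement j| ≤ 1 := by
      unfold displacement; split_ifs <;> simp
    have : N < |x - displacement j| := by
      have := abs_sub_abs_le_abs_sub x (displacement j)
      omega
    simp [shift, h _ this]
  induction t generalizing x with
  | zero =>
    funext j
    have : x ≠ 0 := by rintro rfl; simp at hx
    simp [state, initial, this]
  | succ t ih =>
    rw [state, Function.iterate_succ_apply', step]
    refine hshift _ (2 * t + 1) (hflip _ _ _ (hshift _ (2 * t) (hflip _ _ _ ih))) x ?_
    push_cast at hx
    omega

lemma integral_exp_int (n : ℤ) :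
    ∫ k in (-Real.pi)..Real.pi, exp (n * k * I) = if n = 0 then 2 * (Real.pi : ℂ) else 0 := by
  split_ifs with h
  · simp [h]; ring
  · have hn : (n : ℂ) * I ≠ 0 := by simp [h]
    have := integral_exp_mul_complex (a := -Real.pi) (b := Real.pi) hn
    simp only [show ∀ k : ℝ, (n : ℂ) * k * I = n * I * k from fun k => by ring]
    rw [this, div_eq_zero_iff, sub_eq_zero]
    left
    rw [Complex.exp_eq_exp_iff_exists_int]
    exact ⟨n, by push_cast; ring⟩

/-- Parseval's identity for a trigonometric polynomial and its translate by `τ`. -/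
lemma integral_conj_mul_shift (f : ℤ → ℂ) (s : Finset ℤ) (τ : ℝ) :
    ∫ k in (-Real.pi)..Real.pi, conj (∑ x ∈ s, exp (-(k * x * I)) * f x)
        * ∑ x ∈ s, exp (-((k - τ : ℝ) * x * I)) * f x
      = 2 * Real.pi * ∑ x ∈ s, exp (τ * x * I) * (‖f x‖ ^ 2 : ℝ) := by
  have h : ∀ k : ℝ, conj (∑ x ∈ s, exp (-(k * x * I)) * f x)
        * ∑ x ∈ s, exp (-((k - τ : ℝ) * x * I)) * f x
      = ∑ x ∈ s, ∑ y ∈ s, (conj (f x) * f y * exp (τ * y * I)) * exp ((x - y : ℤ) * k * I) := by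
    intro k
    rw [map_sum, Finset.sum_mul_sum]
    refine Finset.sum_congr rfl fun x _ => Finset.sum_congr rfl fun y _ => ?_
    rw [map_mul, ← Complex.exp_conj]
    have : conj (f x) * f y * exp (τ * y * I) * exp ((x - y : ℤ) * k * I)
      = (exp (τ * y * I + (x - y : ℤ) * k * I)) * (conj (f x) * f y) := by
      rw [Complex.exp_add]; ring
    rw [this, mul_mul_mul_comm, ← Complex.exp_add]
    congr 2
    simp
    ring
  simp only [h]
  rw [intervalIntegral.integral_finsetSum
      fun x _ => Continuous.intervalIntegrable (by fun_prop) _ _,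
    Finset.mul_sum]
  refine Finset.sum_congr rfl fun x hx => ?_
  rw [intervalIntegral.integral_finsetSum
    fun x _ => Continuous.intervalIntegrable (by fun_prop) _ _]
  simp only [intervalIntegral.integral_const_mul, integral_exp_int, sub_eq_zero]
  simp only [mul_ite, mul_zero, Finset.sum_ite_eq, hx, if_true]
  rw [mul_comm (conj (f x)), Complex.mul_conj, Complex.normSq_eq_norm_sq]
  ring

/-- The characteristic function of the position as an integral over the momentum. -/
lemma sum_exp_weight (θ : Fin 2 → ℝ) (q : Fin 4 → ℂ) (t : ℕ) (τ : ℝ) :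
    ∑ x ∈ Finset.Icc (-(2 * t : ℤ)) (2 * t), exp (τ * x * I) * (weight (state θ q t) x : ℝ)
      = (2 * Real.pi : ℂ)⁻¹ * ∫ k in (-Real.pi)..Real.pi,
        star (((walkSymbol (θ 0) (θ 1) k ^ t) ⊗ₖ (walkSymbol (θ 1) (θ 0) k ^ t)).mulVec (amp q)) ⬝ᵥ
        ((walkSymbol (θ 0) (θ 1) (k - τ) ^ t) ⊗ₖ (walkSymbol (θ 1) (θ 0) (k - τ) ^ t)).mulVec
          (amp q) := by
  have hF : ∀ (k : ℝ) j,
      ((walkSymbol (θ 0) (θ 1) k ^ t) ⊗ₖ (walkSymbol (θ 1) (θ 0) k ^ t)).mulVec (amp q) j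
      = ∑ x ∈ Finset.Icc (-(2 * t : ℤ)) (2 * t), exp (-(k * x * I)) * state θ q t x j := by
    intro k j
    refine (isFourier_state θ q t k j).unique (hasSum_sum_of_ne_finset_zero fun x hx => ?_)
    rw [state_eq_zero θ q t x, Pi.zero_apply, mul_zero]
    rw [Finset.mem_Icc, ← abs_le] at hx
    omega
  have h1 : ∀ k : ℝ,
      star (((walkSymbol (θ 0) (θ 1) k ^ t) ⊗ₖ (walkSymbol (θ 1) (θ 0) k ^ t)).mulVec (amp q)) ⬝ᵥ
        ((walkSymbol (θ 0) (θ 1) (k - τ) ^ t) ⊗ₖ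
          (walkSymbol (θ 1) (θ 0) (k - τ) ^ t)).mulVec (amp q)
      = ∑ j, conj (∑ x ∈ Finset.Icc (-(2 * t : ℤ)) (2 * t), exp (-(k * x * I)) * state θ q t x j)
        * ∑ x ∈ Finset.Icc (-(2 * t : ℤ)) (2 * t),
          exp (-((k - τ : ℝ) * x * I)) * state θ q t x j := by
    intro k
    simp only [dotProduct, Pi.star_apply, hF, Complex.star_def]
  simp only [h1]
  rw [intervalIntegral.integral_finsetSum
    fun x _ => Continuous.intervalIntegrable (by fun_prop) _ _]
  simp only [integral_conj_mul_shift, ← Finset.mul_sum]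
  have hpi : (2 * Real.pi : ℂ) ≠ 0 := by simp [Real.pi_ne_zero]
  rw [inv_mul_cancel_left₀ hpi, Finset.sum_comm]
  refine Finset.sum_congr rfl fun x _ => ?_
  rw [weight, ← Finset.mul_sum]
  push_cast
  rfl

end

/-! ### The symbol and its rescaled powers -/

section

open Complex ComplexConjugate

/-- `cos ω`, where `e^{±iω}` are the eigenvalues of `walkSymbol a b k`. -/
def gcos (a b k : ℝ) : ℝ := Real.cos a * Real.cos b * Real.cos k + Real.sin a * Real.sin b

/-- `sin ω`, with the sign `sin ω ≥ 0`, where `e^{±iω}` are the eigenvalues of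
`walkSymbol a b k`. -/
def gsin (a b k : ℝ) : ℝ := √(1 - gcos a b k ^ 2)

/-- The velocity `dω/dk` of the eigenvalue phase `ω = arccos (gcos a b k)`; it takes the junk value
`0` where `gsin` vanishes, which for `cos a, cos b ≠ 0` can happen only if `sin k = 0`. -/
def vel (a b k : ℝ) : ℝ := Real.cos a * Real.cos b * Real.sin k / gsin a b k

/-- The numerator of the imaginary part of `axisOff b a k`, and `sin ω` times the cosine of an
angle of a spherical triangle, see `ang`. -/
def cross (a b k : ℝ) : ℝ := Real.sin b * Real.cos a - Real.cos b * Real.sin a * Real.cos k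

/-- The off-diagonal entry of `axis`. -/
def axisOff (a b k : ℝ) : ℂ :=
  ((Real.cos a * Real.sin b * Real.sin k / gsin a b k : ℝ) : ℂ) + I * (cross b a k / gsin a b k : ℝ)

/-- The traceless Hermitian involution `N` with `walkSymbol a b k = cos ω + i sin ω N`. -/
def axis (a b k : ℝ) : Matrix (Fin 2) (Fin 2) ℂ :=
  !![(vel a b k : ℂ), axisOff a b k; conj (axisOff a b k), -(vel a b k : ℂ)]

lemma gcos_comm (a b k : ℝ) : gcos b a k = gcos a b k := by unfold gcos; ring
lemma gsin_comm (a b k : ℝ) : gsin b a k = gsin a b k := by rw [gsin, gsin, gcos_comm]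
lemma vel_comm (a b k : ℝ) : vel b a k = vel a b k := by rw [vel, vel, gsin_comm]; ring

lemma one_sub_gcos_sq (a b k : ℝ) :
    1 - gcos a b k ^ 2 = (Real.cos b * Real.sin k) ^ 2 + cross a b k ^ 2 := by
  have ha := Real.sin_sq_add_cos_sq a
  have hb := Real.sin_sq_add_cos_sq b
  have hk := Real.sin_sq_add_cos_sq k
  unfold gcos cross
  generalize Real.sin a = sa at *
  generalize Real.cos a = ca at *
  generalize Real.sin b = sb at *
  generalize Real.cos b = cb at *
  generalize Real.sin k = sk at *
  generalize Real.cos k = ck at *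
  rw [← eq_sub_iff_add_eq] at ha hb hk
  ring_nf
  rw [ha, hb, hk]
  ring

lemma one_sub_gcos_sq_nonneg (a b k : ℝ) : 0 ≤ 1 - gcos a b k ^ 2 := by
  rw [one_sub_gcos_sq]; positivity

lemma gsin_nonneg (a b k : ℝ) : 0 ≤ gsin a b k := Real.sqrt_nonneg _

lemma gsin_sq (a b k : ℝ) : gsin a b k ^ 2 = 1 - gcos a b k ^ 2 :=
  Real.sq_sqrt (one_sub_gcos_sq_nonneg a b k)

lemma gsin_sq' (a b k : ℝ) :
    gsin a b k ^ 2 = (Real.cos b * Real.sin k) ^ 2 + cross a b k ^ 2 := by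
  rw [gsin_sq, one_sub_gcos_sq]

lemma gsin_pos {a b k : ℝ} (hb : Real.cos b ≠ 0) (hk : Real.sin k ≠ 0) : 0 < gsin a b k := by
  refine (gsin_nonneg a b k).lt_of_ne' fun h => ?_
  have h1 := gsin_sq' a b k
  rw [h] at h1
  have : 0 < (Real.cos b * Real.sin k) ^ 2 := by positivity
  nlinarith [sq_nonneg (cross a b k)]

lemma continuous_gcos (a b : ℝ) : Continuous (gcos a b) := by unfold gcos; fun_prop
lemma continuous_gsin (a b : ℝ) : Continuous (gsin a b) := by
  have := continuous_gcos a b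
  unfold gsin; fun_prop

lemma axisOff_normSq {a b k : ℝ} (h : 0 < gsin a b k) :
    axisOff a b k * conj (axisOff a b k) = 1 - (vel a b k : ℂ) ^ 2 := by
  rw [Complex.mul_conj]
  norm_cast
  rw [axisOff, Complex.normSq_apply]
  simp only [Complex.add_re, Complex.add_im, Complex.ofReal_re, Complex.ofReal_im, Complex.I_mul_re,
    Complex.I_mul_im, vel]
  have h1 := gsin_sq' b a k
  rw [gsin_comm] at h1
  have hb := Real.sin_sq_add_cos_sq b
  field_simp
  rw [h1]
  ring_nf
  linear_combination (Real.cos a ^ 2 * Real.sin k ^ 2) * hb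

lemma axis_mul_self {a b k : ℝ} (h : 0 < gsin a b k) : axis a b k * axis a b k = 1 := by
  have h1 := axisOff_normSq h
  ext i j
  fin_cases i <;> fin_cases j <;> simp [axis, Matrix.mul_apply, Fin.sum_univ_two]
  · rw [h1]; ring
  · ring
  · ring
  · rw [mul_comm, h1]; ring

lemma axis_isHermitian (a b k : ℝ) : (axis a b k).IsHermitian := by
  ext i j
  fin_cases i <;> fin_cases j <;> simp [axis, Matrix.conjTranspose_apply]

lemma walkSymbol_eq {a b k : ℝ} (h : 0 < gsin a b k) :
    walkSymbol a b k = (gcos a b k : ℂ) • 1 + (I * gsin a b k) • axis a b k := by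
  have hg : (gsin a b k : ℂ) ≠ 0 := by exact_mod_cast h.ne'
  have e1 : exp (k / 2 * I) * exp (k / 2 * I) = (Real.cos k : ℂ) + (Real.sin k : ℂ) * I := by
    rw [← Complex.exp_add, Complex.ofReal_cos, Complex.ofReal_sin, ← Complex.exp_mul_I]
    ring_nf
  have e2 : exp (-(k / 2 * I)) * exp (-(k / 2 * I))
      = (Real.cos k : ℂ) - (Real.sin k : ℂ) * I := by
    have : (Real.cos k : ℂ) - (Real.sin k : ℂ) * I
        = (Real.cos (-k) : ℂ) + (Real.sin (-k) : ℂ) * I := by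
      rw [Real.cos_neg, Real.sin_neg]; push_cast; ring
    rw [this, ← Complex.exp_add, Complex.ofReal_cos, Complex.ofReal_sin, ← Complex.exp_mul_I]
    push_cast
    ring_nf
  have e3 : exp (k / 2 * I) * exp (-(k / 2 * I)) = 1 := by
    rw [← Complex.exp_add]; simp
  simp only [walkSymbol, halfShift, coin, axis, axisOff, vel, gcos, cross]
  generalize exp (k / 2 * I) = z at *
  generalize exp (-(k / 2 * I)) = z' at *
  generalize gsin a b k = g at *
  generalize Real.sin a = sa at *
  generalize Real.cos a = ca at *
  generalize Real.sin b = sb at *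
  generalize Real.cos b = cb at *
  generalize Real.sin k = sk at *
  generalize Real.cos k = ck at *
  ext i j
  fin_cases i <;> fin_cases j <;>
    simp [Matrix.mul_apply, Fin.sum_univ_two, Matrix.diagonal]
  · field_simp
    linear_combination (ca * cb : ℂ) * e1 + (sa * sb : ℂ) * e3
  · field_simp
    linear_combination (ca * sb : ℂ) * e1 - (sa * cb : ℂ) * e3
      - (sa * cb - ca * sb * ck : ℂ) * I_sq
  · field_simp
    linear_combination -(ca * sb : ℂ) * e2 + (sa * cb : ℂ) * e3
      + (sa * cb - ca * sb * ck : ℂ) * I_sq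
  · field_simp
    linear_combination (ca * cb : ℂ) * e2 + (sa * sb : ℂ) * e3

lemma involution_pow {N : Matrix (Fin 2) (Fin 2) ℂ} (hN : N * N = 1) (w : ℝ) (t : ℕ) :
    ((Real.cos w : ℂ) • 1 + (I * Real.sin w) • N) ^ t
      = (Real.cos (t * w) : ℂ) • 1 + (I * Real.sin (t * w)) • N := by
  induction t with
  | zero => simp
  | succ t ih =>
    rw [pow_succ, ih]
    simp only [add_mul, mul_add, smul_mul_smul_comm, hN, mul_one, one_mul]
    push_cast
    rw [show ((t : ℂ) + 1) * w = t * w + w by ring, Complex.cos_add, Complex.sin_add]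
    match_scalars
    · linear_combination (Complex.sin (t * w) * Complex.sin w) * I_sq
    · ring

lemma walkSymbol_pow {a b k : ℝ} (h : 0 < gsin a b k) (t : ℕ) :
    walkSymbol a b k ^ t = (Real.cos (t * Real.arccos (gcos a b k)) : ℂ) • 1
      + (I * Real.sin (t * Real.arccos (gcos a b k))) • axis a b k := by
  have h0 := one_sub_gcos_sq_nonneg a b k
  have h1 : |gcos a b k| ≤ 1 := by rw [← sq_le_one_iff_abs_le_one]; linarith
  rw [abs_le] at h1
  rw [← involution_pow (axis_mul_self h), Real.cos_arccos h1.1 h1.2, Real.sin_arccos,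
    walkSymbol_eq h, gsin]

lemma halfShift_mem_unitary (k : ℝ) : halfShift k ∈ Matrix.unitaryGroup (Fin 2) ℂ := by
  rw [Matrix.mem_unitaryGroup_iff', Matrix.star_eq_conjTranspose, halfShift,
    Matrix.diagonal_conjTranspose, Matrix.diagonal_mul_diagonal, ← Matrix.diagonal_one]
  congr 1
  funext i
  fin_cases i <;> simp [← Complex.exp_conj, ← Complex.exp_add, map_ofNat]

lemma coin_mem_unitary (a : ℝ) : coin a ∈ Matrix.unitaryGroup (Fin 2) ℂ := by
  have h := Complex.sin_sq_add_cos_sq a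
  rw [Matrix.mem_unitaryGroup_iff']
  ext i j
  fin_cases i <;> fin_cases j <;>
    simp [coin, Matrix.mul_apply, Fin.sum_univ_two, Matrix.star_eq_conjTranspose,
      ← Complex.cos_conj, ← Complex.sin_conj]
  · linear_combination h
  · ring
  · ring
  · linear_combination h

lemma walkSymbol_mem_unitary (a b k : ℝ) : walkSymbol a b k ∈ Matrix.unitaryGroup (Fin 2) ℂ :=
  mul_mem (mul_mem (halfShift_mem_unitary k) (coin_mem_unitary a))
    (mul_mem (halfShift_mem_unitary k) (coin_mem_unitary b))

lemma continuous_walkSymbol (a b : ℝ) : Continuous (walkSymbol a b) := by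
  have : Continuous halfShift := by
    unfold halfShift
    refine Continuous.matrix_diagonal (continuous_pi fun i => ?_)
    fin_cases i <;> simp <;> fun_prop
  unfold walkSymbol
  fun_prop

lemma continuousAt_axis {a b k : ℝ} (h : 0 < gsin a b k) : ContinuousAt (axis a b) k := by
  have h1 := (continuous_gsin a b).continuousAt (x := k)
  have hv : ContinuousAt (vel a b) k := by
    unfold vel; exact ContinuousAt.div (by fun_prop) h1 h.ne'
  have ho : ContinuousAt (axisOff a b) k := by
    have e1 : ContinuousAt (fun k => Real.cos a * Real.sin b * Real.sin k / gsin a b k) k :=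
      ContinuousAt.div (by fun_prop) h1 h.ne'
    have e2 : ContinuousAt (fun k => cross b a k / gsin a b k) k :=
      ContinuousAt.div (by unfold cross; fun_prop) h1 h.ne'
    unfold axisOff
    fun_prop
  refine tendsto_pi_nhds.2 fun i => tendsto_pi_nhds.2 fun j => ?_
  fin_cases i <;> fin_cases j <;> simp only [axis] <;> simp
  · exact (continuous_ofReal.continuousAt.comp hv).tendsto
  · exact ho.tendsto
  · exact (continuous_conj.continuousAt.comp ho).tendsto
  · exact (continuous_ofReal.continuousAt.comp hv).tendsto

lemma hasDerivAt_arccos_gcos {a b k : ℝ} (h : 0 < gsin a b k) :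
    HasDerivAt (fun k => Real.arccos (gcos a b k)) (vel a b k) k := by
  have h0 : gcos a b k ^ 2 < 1 := by
    have := gsin_sq a b k
    have : 0 < gsin a b k ^ 2 := by positivity
    linarith
  have h1 : gcos a b k ≠ -1 := by intro h; rw [h] at h0; norm_num at h0
  have h2 : gcos a b k ≠ 1 := by intro h; rw [h] at h0; norm_num at h0
  have hg : HasDerivAt (gcos a b) (Real.cos a * Real.cos b * -Real.sin k) k :=
    ((Real.hasDerivAt_cos k).const_mul _).add_const _
  refine ((Real.hasDerivAt_arccos h1 h2).comp k hg).congr_deriv ?_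
  rw [vel, gsin]; ring

/-- The phase difference `t (ω(k - ξ/t) - ω(k))` converges, being a difference quotient of `ω`. -/
lemma tendsto_phase {a b k : ℝ} (h : 0 < gsin a b k) (ξ : ℝ) :
    Tendsto (fun t : ℕ => t * Real.arccos (gcos a b (k - ξ / t)) - t * Real.arccos (gcos a b k))
      atTop (𝓝 (-(ξ * vel a b k))) := by
  have h1 : HasDerivAt (fun x : ℝ => Real.arccos (gcos a b (k - ξ * x))) (-(ξ * vel a b k)) 0 := by
    have h2 : HasDerivAt (fun x : ℝ => k - ξ * x) (-ξ) 0 := by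
      simpa using ((hasDerivAt_id (0 : ℝ)).const_mul ξ).const_sub k
    have h3 : HasDerivAt (fun k => Real.arccos (gcos a b k)) (vel a b k) (k - ξ * 0) := by
      simpa using hasDerivAt_arccos_gcos h
    have h4 := h3.comp (0 : ℝ) h2
    rwa [mul_neg, mul_comm (vel a b k)] at h4
  have h4 := (hasDerivAt_iff_tendsto_slope_zero.1 h1).comp
    ((tendsto_inv_atTop_nhdsGT_zero.mono_right (nhdsGT_le_nhdsNE 0)).comp
      (tendsto_natCast_atTop_atTop (R := ℝ)))
  refine h4.congr fun t => ?_
  simp [div_eq_mul_inv, mul_sub]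

/-- Bounded coefficients are enough: the phases `t ω` themselves do not converge. -/
lemma tendsto_smul_zero_of_norm_le_one {c : ℕ → ℂ} {A : ℕ → Matrix (Fin 2) (Fin 2) ℂ}
    (hc : ∀ n, ‖c n‖ ≤ 1) (hA : Tendsto A atTop (𝓝 0)) :
    Tendsto (fun n => c n • A n) atTop (𝓝 0) := by
  refine tendsto_pi_nhds.2 fun i => tendsto_pi_nhds.2 fun j => ?_
  have h := tendsto_pi_nhds.1 (tendsto_pi_nhds.1 hA i) j
  refine squeeze_zero_norm (fun n => ?_) (by simpa using h.norm)
  rw [Matrix.smul_apply, norm_smul]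
  exact mul_le_of_le_one_left (norm_nonneg _) (hc n)

/-- The product `e^{-ixN} e^{iyN'}`, split into `e^{i(y-x)N}` and terms that are small when `N'` is
close to `N`. -/
lemma involution_exp_mul {N N' : Matrix (Fin 2) (Fin 2) ℂ} (hN : N * N = 1) (x y : ℝ) :
    ((Real.cos x : ℂ) • 1 - (I * Real.sin x) • N) * ((Real.cos y : ℂ) • 1 + (I * Real.sin y) • N')
      = (Real.cos (y - x) : ℂ) • 1 + (I * Real.sin (y - x)) • N
        + ((Real.sin x * Real.sin y : ℝ) : ℂ) • (N * (N' - N))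
        + (I * ((Real.cos x * Real.sin y : ℝ) : ℂ)) • (N' - N) := by
  simp only [sub_mul, mul_add, mul_sub, smul_mul_smul_comm, mul_one, one_mul, hN, Real.sin_sub,
    Real.cos_sub]
  push_cast
  match_scalars
  · ring
  · ring
  · ring
  · linear_combination (-Complex.sin x * Complex.sin y) * I_sq

/-- Comparing `t`-th powers at momenta `k` and `k - ξ/t` leaves only the difference of the phases,
since the axes `N(k - ξ/t)` converge to `N(k)`. -/
lemma tendsto_walkSymbol_pow {a b k : ℝ} (h : 0 < gsin a b k) (ξ : ℝ) :
    Tendsto (fun t : ℕ => star (walkSymbol a b k ^ t) * walkSymbol a b (k - ξ / t) ^ t) atTop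
      (𝓝 ((Real.cos (ξ * vel a b k) : ℂ) • 1 - (I * Real.sin (ξ * vel a b k)) • axis a b k)) := by
  have hk : Tendsto (fun t : ℕ => k - ξ / t) atTop (𝓝 k) := by
    simpa using tendsto_const_nhds.sub (tendsto_const_div_atTop_nhds_zero_nat ξ)
  have hpos : ∀ᶠ t : ℕ in atTop, 0 < gsin a b (k - ξ / t) :=
    ((continuous_gsin a b).tendsto k |>.comp hk).eventually_const_lt h
  set w := fun x => Real.arccos (gcos a b x) with hw
  have hN : Tendsto (fun t : ℕ => axis a b (k - ξ / t) - axis a b k) atTop (𝓝 0) := by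
    simpa using ((continuousAt_axis h).tendsto.comp hk).sub_const (axis a b k)
  have hNN : Tendsto (fun t : ℕ => axis a b k * (axis a b (k - ξ / t) - axis a b k)) atTop
      (𝓝 0) := by
    simpa using tendsto_const_nhds (x := axis a b k) |>.mul hN
  have hph := tendsto_phase h ξ
  have hcos := (continuous_ofReal.comp Real.continuous_cos).tendsto _ |>.comp hph
  have hsin := (continuous_ofReal.comp Real.continuous_sin).tendsto _ |>.comp hph
  have h1 := tendsto_smul_zero_of_norm_le_one
    (c := fun t : ℕ => ((Real.sin (t * w k) * Real.sin (t * w (k - ξ / t)) : ℝ) : ℂ))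
    (fun t => by
      rw [Complex.norm_real, norm_mul]
      exact mul_le_one₀ (Real.abs_sin_le_one _) (norm_nonneg _) (Real.abs_sin_le_one _)) hNN
  have h2 := tendsto_smul_zero_of_norm_le_one
    (c := fun t : ℕ => I * ((Real.cos (t * w k) * Real.sin (t * w (k - ξ / t)) : ℝ) : ℂ))
    (fun t => by
      rw [norm_mul, Complex.norm_I, one_mul, Complex.norm_real, norm_mul]
      exact mul_le_one₀ (Real.abs_cos_le_one _) (norm_nonneg _) (Real.abs_sin_le_one _)) hN
  have h3 := (((hcos.smul_const (1 : Matrix (Fin 2) (Fin 2) ℂ)).add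
    ((hsin.const_mul I).smul_const (axis a b k))).add h1).add h2
  refine (h3.congr' ?_).trans (le_of_eq ?_)
  · filter_upwards [hpos] with t ht
    rw [walkSymbol_pow h, walkSymbol_pow ht]
    have hs : star ((Real.cos (t * Real.arccos (gcos a b k)) : ℂ) • 1
        + (I * Real.sin (t * Real.arccos (gcos a b k))) • axis a b k)
      = (Real.cos (t * Real.arccos (gcos a b k)) : ℂ) • 1
        - (I * Real.sin (t * Real.arccos (gcos a b k))) • axis a b k := by
      rw [star_add, star_smul, star_smul, star_one, Matrix.star_eq_conjTranspose,
        (axis_isHermitian a b k).eq]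
      simp only [Complex.star_def, map_mul, Complex.conj_ofReal, Complex.conj_I]
      module
    rw [hs, involution_exp_mul (axis_mul_self h)]
    simp only [Function.comp_apply, hw]
  · congr 1
    simp
    module

end

/-! ### Convergence of the characteristic functions -/

section

open Complex ComplexConjugate

/-- The sesquilinear form `⟨φ, (G ⊗ H) φ⟩`. -/
def tensorForm (φ : Fin 2 × Fin 2 → ℂ) (G H : Matrix (Fin 2) (Fin 2) ℂ) : ℂ :=
  star φ ⬝ᵥ (G ⊗ₖ H).mulVec φ

lemma tensorForm_eq_sum (φ : Fin 2 × Fin 2 → ℂ) (G H : Matrix (Fin 2) (Fin 2) ℂ) :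
    tensorForm φ G H = ∑ i, star (φ i) * ∑ j, G i.1 j.1 * H i.2 j.2 * φ j := rfl

lemma continuous_tensorForm (φ : Fin 2 × Fin 2 → ℂ) :
    Continuous fun p : Matrix (Fin 2) (Fin 2) ℂ × Matrix (Fin 2) (Fin 2) ℂ =>
      tensorForm φ p.1 p.2 := by
  simp only [tensorForm_eq_sum]
  refine continuous_finsetSum _ fun i _ => continuous_const.mul <|
    continuous_finsetSum _ fun j _ => ?_
  exact ((continuous_fst.matrix_elem _ _).mul (continuous_snd.matrix_elem _ _)).mul continuous_const

lemma norm_tensorForm_le (φ : Fin 2 × Fin 2 → ℂ) {G H : Matrix (Fin 2) (Fin 2) ℂ}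
    (hG : G ∈ Matrix.unitaryGroup (Fin 2) ℂ) (hH : H ∈ Matrix.unitaryGroup (Fin 2) ℂ) :
    ‖tensorForm φ G H‖ ≤ ∑ i, ‖φ i‖ * ∑ j, ‖φ j‖ := by
  rw [tensorForm_eq_sum]
  refine (norm_sum_le _ _).trans (Finset.sum_le_sum fun i _ => ?_)
  rw [norm_mul, norm_star]
  refine mul_le_mul_of_nonneg_left ((norm_sum_le _ _).trans (Finset.sum_le_sum fun j _ => ?_))
    (norm_nonneg _)
  rw [norm_mul, norm_mul]
  refine mul_le_of_le_one_left (norm_nonneg _) (mul_le_one₀ ?_ (norm_nonneg _) ?_)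
  · exact entry_norm_bound_of_unitary hG _ _
  · exact entry_norm_bound_of_unitary hH _ _

lemma star_mulVec_dotProduct (φ : Fin 2 × Fin 2 → ℂ) (A B A' B' : Matrix (Fin 2) (Fin 2) ℂ) :
    star ((A ⊗ₖ B).mulVec φ) ⬝ᵥ (A' ⊗ₖ B').mulVec φ = tensorForm φ (star A * A') (star B * B') := by
  rw [tensorForm, Matrix.mul_kronecker_mul, Matrix.star_mulVec, ← Matrix.dotProduct_mulVec,
    Matrix.mulVec_mulVec, Matrix.conjTranspose_kronecker, Matrix.star_eq_conjTranspose,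
    Matrix.star_eq_conjTranspose]

/-- The limit of `(A(k)^t)⋆ A(k - ξ/t)^t` for `A = walkSymbol a b`. -/
def phaseMatrix (ξ a b k : ℝ) : Matrix (Fin 2) (Fin 2) ℂ :=
  (Real.cos (ξ * vel a b k) : ℂ) • 1 - (I * Real.sin (ξ * vel a b k)) • axis a b k

lemma ae_sin_ne_zero : ∀ᵐ k : ℝ, Real.sin k ≠ 0 := by
  have : {k : ℝ | ¬ Real.sin k ≠ 0} ⊆ Set.range fun n : ℤ => (n : ℝ) * Real.pi := by
    intro k hk
    simp only [ne_eq, not_not, Set.mem_ofPred_eq] at hk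
    exact Real.sin_eq_zero_iff.1 hk
  exact ((Set.countable_range _).mono this).measure_zero _

lemma integral_symm_eq {f : ℝ → ℂ} (hf : Continuous f) (r : ℝ) :
    ∫ k in (-r)..r, f k = ∫ k in (0)..r, (f k + f (-k)) := by
  have hf' : Continuous fun k => f (-k) := by fun_prop
  rw [← intervalIntegral.integral_add_adjacent_intervals (b := 0) (hf.intervalIntegrable _ _)
    (hf.intervalIntegrable _ _), intervalIntegral.integral_add (hf.intervalIntegrable _ _)
    (hf'.intervalIntegrable _ _), intervalIntegral.integral_comp_neg, neg_zero, add_comm]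

/-- Dominated convergence, with the integral over `(-π, π)` folded to `(0, π)`. -/
lemma tendsto_integral_tensorForm {a b : ℝ} (ha : Real.cos a ≠ 0) (hb : Real.cos b ≠ 0)
    (φ : Fin 2 × Fin 2 → ℂ) (ξ : ℝ) :
    Tendsto (fun t : ℕ => ∫ k in (-Real.pi)..Real.pi,
      star (((walkSymbol a b k ^ t) ⊗ₖ (walkSymbol b a k ^ t)).mulVec φ) ⬝ᵥ
        ((walkSymbol a b (k - (ξ / t : ℝ)) ^ t) ⊗ₖ
          (walkSymbol b a (k - (ξ / t : ℝ)) ^ t)).mulVec φ) atTop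
      (𝓝 (∫ k in (0)..Real.pi,
        (tensorForm φ (phaseMatrix ξ a b k) (phaseMatrix ξ b a k)
          + tensorForm φ (phaseMatrix ξ a b (-k)) (phaseMatrix ξ b a (-k))))) := by
  simp only [star_mulVec_dotProduct]
  have hcont : ∀ (a b : ℝ) (t : ℕ), Continuous fun k =>
      star (walkSymbol a b k ^ t) * walkSymbol a b (k - (ξ / t : ℝ)) ^ t := by
    intro a b t
    have := continuous_walkSymbol a b
    fun_prop
  have hT : ∀ t : ℕ, Continuous fun k =>
      tensorForm φ (star (walkSymbol a b k ^ t) * walkSymbol a b (k - (ξ / t : ℝ)) ^ t)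
        (star (walkSymbol b a k ^ t) * walkSymbol b a (k - (ξ / t : ℝ)) ^ t) := by
    intro t
    have h := (continuous_tensorForm φ).comp ((hcont a b t).prodMk (hcont b a t))
    simpa only [Function.comp_def] using h
  have hmem : ∀ (a b k : ℝ) (t : ℕ),
      star (walkSymbol a b k ^ t) * walkSymbol a b (k - (ξ / t : ℝ)) ^ t
      ∈ Matrix.unitaryGroup (Fin 2) ℂ := fun a b k t =>
    mul_mem (Unitary.star_mem (pow_mem (walkSymbol_mem_unitary a b k) t))
      (pow_mem (walkSymbol_mem_unitary a b _) t)
  have hlim : ∀ k, Real.sin k ≠ 0 → Tendsto (fun t : ℕ =>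
      tensorForm φ (star (walkSymbol a b k ^ t) * walkSymbol a b (k - (ξ / t : ℝ)) ^ t)
        (star (walkSymbol b a k ^ t) * walkSymbol b a (k - (ξ / t : ℝ)) ^ t)) atTop
      (𝓝 (tensorForm φ (phaseMatrix ξ a b k) (phaseMatrix ξ b a k))) := by
    intro k hk
    have h1 := tendsto_walkSymbol_pow (gsin_pos (a := a) hb hk) ξ
    have h2 := tendsto_walkSymbol_pow (gsin_pos (a := b) ha hk) ξ
    have h3 := ((continuous_tensorForm φ).tendsto _).comp (h1.prodMk_nhds h2)
    simp only [phaseMatrix]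
    exact h3
  simp only [fun t => integral_symm_eq (hT t) Real.pi]
  refine intervalIntegral.tendsto_integral_filter_of_dominated_convergence
    (fun _ => (∑ i, ‖φ i‖ * ∑ j, ‖φ j‖) + ∑ i, ‖φ i‖ * ∑ j, ‖φ j‖)
    (Eventually.of_forall fun t => ?_)
    (Eventually.of_forall fun t => Eventually.of_forall fun k _ =>
      (norm_add_le _ _).trans (add_le_add (norm_tensorForm_le φ (hmem a b k t) (hmem b a k t))
        (norm_tensorForm_le φ (hmem a b (-k) t) (hmem b a (-k) t)))) (by simp) ?_
  · exact ((hT t).add ((hT t).comp continuous_neg)).aestronglyMeasurable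
  · filter_upwards [ae_sin_ne_zero] with k hk _
    exact (hlim k hk).add (hlim (-k) (by rwa [Real.sin_neg, neg_ne_zero]))

lemma weight_nonneg (ψ : Wave) (x : ℤ) : 0 ≤ weight ψ x :=
  Finset.sum_nonneg fun _ _ => by positivity

lemma weight_state_eq_zero (θ : Fin 2 → ℝ) (q : Fin 4 → ℂ) (t : ℕ) (x : ℤ)
    (hx : x ∉ Finset.Icc (-(2 * t : ℤ)) (2 * t)) : weight (state θ q t) x = 0 := by
  rw [Finset.mem_Icc, ← abs_le] at hx
  simp [weight, state_eq_zero θ q t x (by omega)]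

/-- The law of `X_t / t`. -/
def rescaledLaw (θ : Fin 2 → ℝ) (q : Fin 4 → ℂ) (hq : ∑ i, ‖q i‖ ^ 2 = 1) (t : ℕ) : Measure ℝ :=
  (positionLaw θ q hq t).toMeasure.map fun n : ℤ => (n : ℝ) / t

instance (θ : Fin 2 → ℝ) (q : Fin 4 → ℂ) (hq : ∑ i, ‖q i‖ ^ 2 = 1) (t : ℕ) :
    IsProbabilityMeasure (rescaledLaw θ q hq t) :=
  Measure.isProbabilityMeasure_map Measurable.of_discrete.aemeasurable

lemma rescaledCDF_eq (θ : Fin 2 → ℝ) (q : Fin 4 → ℂ) (hq : ∑ i, ‖q i‖ ^ 2 = 1) (t : ℕ) (x : ℝ) :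
    rescaledCDF θ q hq t x = (rescaledLaw θ q hq t).real (Set.Iic x) := by
  rw [rescaledLaw, map_measureReal_apply Measurable.of_discrete measurableSet_Iic]
  rfl

lemma charFun_rescaledLaw (θ : Fin 2 → ℝ) (q : Fin 4 → ℂ) (hq : ∑ i, ‖q i‖ ^ 2 = 1) (t : ℕ)
    (ξ : ℝ) : charFun (rescaledLaw θ q hq t) ξ
      = ∑ x ∈ Finset.Icc (-(2 * t : ℤ)) (2 * t),
          exp ((ξ / t : ℝ) * x * I) * (weight (state θ q t) x : ℝ) := by
  rw [charFun_apply_real, rescaledLaw, integral_map Measurable.of_discrete.aemeasurable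
    (by fun_prop), PMF.integral_eq_tsum]
  · rw [tsum_eq_sum (s := Finset.Icc (-(2 * t : ℤ)) (2 * t))]
    · refine Finset.sum_congr rfl fun x _ => ?_
      rw [show positionLaw θ q hq t x = ENNReal.ofReal (weight (state θ q t) x) from rfl,
        ENNReal.toReal_ofReal (weight_nonneg _ _), Complex.real_smul, mul_comm]
      push_cast
      ring_nf
    · intro x hx
      rw [show positionLaw θ q hq t x = ENNReal.ofReal (weight (state θ q t) x) from rfl,
        weight_state_eq_zero θ q t x hx]
      simp
  · refine Integrable.of_bound Measurable.of_discrete.aestronglyMeasurable 1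
      (Eventually.of_forall fun x => ?_)
    rw [show (ξ : ℂ) * ((x / t : ℝ) : ℂ) * I = ((ξ * (x / t) : ℝ) : ℂ) * I by push_cast; ring,
      Complex.norm_exp_ofReal_mul_I]

lemma tendsto_charFun_rescaledLaw (θ : Fin 2 → ℝ) (hc : ∀ i, Real.cos (θ i) ≠ 0) (q : Fin 4 → ℂ)
    (hq : ∑ i, ‖q i‖ ^ 2 = 1) (ξ : ℝ) :
    Tendsto (fun t => charFun (rescaledLaw θ q hq t) ξ) atTop
      (𝓝 ((2 * Real.pi : ℂ)⁻¹ * ∫ k in (0)..Real.pi,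
        (tensorForm (amp q) (phaseMatrix ξ (θ 0) (θ 1) k) (phaseMatrix ξ (θ 1) (θ 0) k)
          + tensorForm (amp q) (phaseMatrix ξ (θ 0) (θ 1) (-k))
              (phaseMatrix ξ (θ 1) (θ 0) (-k))))) := by
  simp only [charFun_rescaledLaw, sum_exp_weight]
  exact (tendsto_integral_tensorForm (hc 0) (hc 1) (amp q) ξ).const_mul _

end

/-! ### The angle attached to the velocity -/

/-- The complement of the angle opposite to the side `π/2 - b` in the spherical triangle
whose sides `π/2 - a` and `π/2 - b` enclose the angle `k`; the third side is
`ω = arccos (gcos a b k)`. -/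
def ang (a b k : ℝ) : ℝ := Real.arcsin (cross a b k / gsin a b k)

/-- The derivative of `ang a b`, up to the sign of `cos b`. -/
def dang (a b k : ℝ) : ℝ := Real.cos b * cross b a k / gsin a b k ^ 2

lemma cos_ang {a b k : ℝ} (hb : Real.cos b ≠ 0) (hk : 0 < Real.sin k) :
    Real.cos (ang a b k) = |Real.cos b| * Real.sin k / gsin a b k := by
  have hg := gsin_pos (a := a) hb hk.ne'
  rw [ang, Real.cos_arcsin]
  have : 1 - (cross a b k / gsin a b k) ^ 2 = (|Real.cos b| * Real.sin k / gsin a b k) ^ 2 := by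
    have h := gsin_sq' a b k
    field_simp
    rw [h, sq_abs]; ring
  rw [this, Real.sqrt_sq (by positivity)]

/-- The sine rule in the triangle of `ang`. The squares suppress the sign of `cos b`. -/
lemma vel_sq_eq {a b k : ℝ} (hb : Real.cos b ≠ 0) (hk : 0 < Real.sin k) :
    vel a b k ^ 2 = (Real.cos a * Real.cos (ang a b k)) ^ 2 := by
  rw [cos_ang hb hk, vel, mul_div_assoc', div_pow, div_pow]
  congr 1
  have := sq_abs (Real.cos b)
  linear_combination -(Real.cos a ^ 2 * Real.sin k ^ 2) * this

lemma sign_mul_self (x : ℝ) : Real.sign x * x = |x| := by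
  rcases lt_trichotomy x 0 with h | rfl | h
  · rw [Real.sign_of_neg h, abs_of_neg h]; ring
  · simp
  · rw [Real.sign_of_pos h, abs_of_pos h]; ring

lemma sign_mul_abs (x : ℝ) : Real.sign x * |x| = x := by
  rcases lt_trichotomy x 0 with h | rfl | h
  · rw [Real.sign_of_neg h, abs_of_neg h]; ring
  · simp
  · rw [Real.sign_of_pos h, abs_of_pos h]; ring

lemma hasDerivAt_ang {a b k : ℝ} (hb : Real.cos b ≠ 0) (hk : 0 < Real.sin k) :
    HasDerivAt (ang a b) (Real.sign (Real.cos b) * dang a b k) k := by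
  have hg := gsin_pos (a := a) hb hk.ne'
  have hcos := cos_ang (a := a) hb hk
  have hpos : 0 < |Real.cos b| * Real.sin k / gsin a b k := by positivity
  rw [ang, Real.cos_arcsin] at hcos
  have hne : ∀ e : ℝ, e ^ 2 = 1 → cross a b k / gsin a b k ≠ e := by
    intro e he h
    rw [h, he, sub_self, Real.sqrt_zero] at hcos
    exact hpos.ne hcos
  have h1 : HasDerivAt (cross a b) (Real.cos b * Real.sin a * Real.sin k) k := by
    unfold cross
    exact (((Real.hasDerivAt_cos k).const_mul (Real.cos b * Real.sin a)).const_sub _).congr_deriv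
      (by ring)
  have h0 : HasDerivAt (gcos a b) (-(Real.cos a * Real.cos b * Real.sin k)) k := by
    unfold gcos
    exact (((Real.hasDerivAt_cos k).const_mul _).add_const _).congr_deriv (by ring)
  have hs : (1 - gcos a b k ^ 2) ≠ 0 := by rw [← gsin_sq]; positivity
  have h2 : HasDerivAt (gsin a b)
      (gcos a b k * (Real.cos a * Real.cos b * Real.sin k) / gsin a b k) k := by
    refine (((h0.pow 2).const_sub 1).sqrt hs).congr_deriv ?_
    change _ / (2 * gsin a b k) = _
    field_simp
    push_cast
    ring
  refine ((Real.hasDerivAt_arcsin (hne (-1) (by norm_num)) (hne 1 (by norm_num))).comp k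
    (h1.div h2 hg.ne')).congr_deriv ?_
  rw [hcos, dang]
  have h3 := gsin_sq a b k
  have hk2 := Real.sin_sq_add_cos_sq k
  have ha2 := Real.sin_sq_add_cos_sq a
  have hb2 := Real.sin_sq_add_cos_sq b
  have hab : |Real.cos b| ≠ 0 := by simpa using hb
  have hsg := sign_mul_self (Real.cos b)
  field_simp
  rw [h3]
  have e : Real.sin a * (1 - gcos a b k ^ 2) - cross a b k * gcos a b k * Real.cos a
      = Real.cos b * cross b a k := by
    unfold gcos cross
    linear_combination
      -(Real.sin b * (Real.cos a * Real.cos b * Real.cos k + Real.sin a * Real.sin b)) * ha2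
        - Real.sin a * hb2
  rcases lt_or_gt_of_ne hb with h | h
  · rw [Real.sign_of_neg h, abs_of_neg h]
    linear_combination e
  · rw [Real.sign_of_pos h, abs_of_pos h]
    linear_combination e

/-- At the zeros of `sin k` the angle `ang a b` tends to `± π/2`, or to `0` when `cross a b`
vanishes there; in the latter case `gsin a b` vanishes as well and the quotient has to be
estimated. -/
lemma tendsto_ang {a b k₀ : ℝ} (hb : Real.cos b ≠ 0) (hk₀ : Real.sin k₀ = 0) {l : Filter ℝ}
    (hl : l ≤ 𝓝 k₀) (hs : ∀ᶠ k in l, Real.sin k ≠ 0) :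
    Tendsto (ang a b) l (𝓝 (Real.arcsin (Real.sign (cross a b k₀)))) := by
  refine (Real.continuous_arcsin.tendsto _).comp ?_
  have hcr : Continuous (cross a b) := by unfold cross; fun_prop
  have hg0 := gsin_sq' a b k₀
  rw [hk₀, mul_zero, zero_pow two_ne_zero, zero_add] at hg0
  by_cases h0 : cross a b k₀ = 0
  · rw [h0, Real.sign_zero]
    have he : Real.cos k₀ ^ 2 = 1 := by
      have := Real.sin_sq_add_cos_sq k₀
      rw [hk₀] at this
      linarith
    have hc : ∀ᶠ k in l, 0 < Real.cos k₀ * Real.cos k := by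
      have h : ContinuousAt (fun k => Real.cos k₀ * Real.cos k) k₀ := by fun_prop
      exact (h.eventually_const_lt (by nlinarith)).filter_mono hl
    have hz : Tendsto (fun k => |Real.sin a| * |Real.sin k|) l (𝓝 0) := by
      have : ContinuousAt (fun k => |Real.sin a| * |Real.sin k|) k₀ := by fun_prop
      have := this.tendsto.mono_left hl
      rwa [hk₀, abs_zero, mul_zero] at this
    refine squeeze_zero_norm' ?_ hz
    filter_upwards [hs, hc] with k hk hck
    have hg := gsin_pos (a := a) hb hk
    have hgb : |Real.cos b| * |Real.sin k| ≤ gsin a b k := by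
      rw [← abs_mul]
      refine abs_le_of_sq_le_sq ?_ hg.le
      have := gsin_sq' a b k
      nlinarith [sq_nonneg (cross a b k)]
    have hx : cross a b k = Real.cos b * Real.sin a * (Real.cos k₀ - Real.cos k) := by
      have : cross a b k = cross a b k - cross a b k₀ := by rw [h0, sub_zero]
      rw [this]; unfold cross; ring
    have hd : |Real.cos k₀ - Real.cos k| ≤ |Real.sin k| ^ 2 := by
      rw [sq_abs, Real.sin_sq]
      have h1 : Real.cos k₀ * Real.cos k ≤ 1 := by
        nlinarith [Real.cos_sq_le_one k, sq_nonneg (Real.cos k₀ - Real.cos k)]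
      have h2 : (Real.cos k₀ * Real.cos k) ^ 2 = Real.cos k ^ 2 := by rw [mul_pow, he, one_mul]
      refine abs_le_of_sq_le_sq ?_ (by nlinarith [Real.cos_sq_le_one k])
      have h3 : (Real.cos k₀ - Real.cos k) ^ 2 = (1 - Real.cos k₀ * Real.cos k) ^ 2 := by
        linear_combination (1 - Real.cos k ^ 2) * he
      rw [h3]
      refine pow_le_pow_left₀ (by linarith) ?_ 2
      nlinarith
    rw [Real.norm_eq_abs, abs_div, abs_of_pos hg, div_le_iff₀ hg, hx, abs_mul, abs_mul]
    calc |Real.cos b| * |Real.sin a| * |Real.cos k₀ - Real.cos k|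
        ≤ |Real.cos b| * |Real.sin a| * |Real.sin k| ^ 2 := by gcongr
      _ = |Real.sin a| * |Real.sin k| * (|Real.cos b| * |Real.sin k|) := by ring
      _ ≤ _ := by gcongr
  · have hg : gsin a b k₀ = |cross a b k₀| := by
      rw [← Real.sqrt_sq (gsin_nonneg a b k₀), hg0, Real.sqrt_sq_eq_abs]
    have hsg : Real.sign (cross a b k₀) = cross a b k₀ / gsin a b k₀ := by
      rw [hg, eq_div_iff (by simpa using h0), sign_mul_abs]
    rw [hsg]
    refine (hcr.tendsto k₀ |>.mono_left hl).div
      ((continuous_gsin a b).tendsto k₀ |>.mono_left hl) ?_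
    rw [hg]; simpa using h0

/-- A form of `dang` that extends continuously across the zeros of `sin k`. -/
lemma dang_eq {a b k : ℝ} (hb : Real.cos b ≠ 0) (hk : Real.sin k ≠ 0) :
    dang a b k = ((Real.sin a + Real.sin b) / (1 + gcos a b k)
      + (Real.sin a - Real.sin b) / (1 - gcos a b k)) / 2 := by
  have hg := gsin_pos (a := a) hb hk
  have h1 := gsin_sq a b k
  have h2 : (1 - gcos a b k) * (1 + gcos a b k) ≠ 0 := by
    rw [show (1 - gcos a b k) * (1 + gcos a b k) = 1 - gcos a b k ^ 2 by ring, ← h1]; positivity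
  have h3 := left_ne_zero_of_mul h2
  have h4 := right_ne_zero_of_mul h2
  have hb2 := Real.sin_sq_add_cos_sq b
  rw [dang, h1, show 1 - gcos a b k ^ 2 = (1 - gcos a b k) * (1 + gcos a b k) by ring]
  field_simp
  unfold cross gcos
  linear_combination 2 * Real.sin a * hb2

/-- The denominator vanishes only if the numerator is zero. -/
lemma continuous_div_one_add_gcos (a b : ℝ) :
    Continuous fun k => (Real.sin a + Real.sin b) / (1 + gcos a b k) := by
  by_cases h : Real.sin a + Real.sin b = 0
  · simp only [h, zero_div]; exact continuous_const
  refine continuous_const.div (continuous_const.add (continuous_gcos a b)) fun k hk => h ?_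
  have ha := Real.sin_sq_add_cos_sq a
  have hb := Real.sin_sq_add_cos_sq b
  have hc := Real.cos_sq_le_one k
  have h1 : (Real.cos a * Real.cos b * Real.cos k) ^ 2 = (1 + Real.sin a * Real.sin b) ^ 2 := by
    unfold gcos at hk
    rw [show Real.cos a * Real.cos b * Real.cos k = -(1 + Real.sin a * Real.sin b) by linarith]
    ring
  have h2 : (1 + Real.sin a * Real.sin b) ^ 2
      = (Real.cos a * Real.cos b) ^ 2 + (Real.sin a + Real.sin b) ^ 2 := by
    rw [mul_pow, eq_sub_of_add_eq' ha, eq_sub_of_add_eq' hb]; ring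
  have h3 : (Real.cos a * Real.cos b * Real.cos k) ^ 2 ≤ (Real.cos a * Real.cos b) ^ 2 := by
    rw [mul_pow]; exact mul_le_of_le_one_right (sq_nonneg _) hc
  nlinarith

/-- The denominator vanishes only if the numerator is zero. -/
lemma continuous_div_one_sub_gcos (a b : ℝ) :
    Continuous fun k => (Real.sin a - Real.sin b) / (1 - gcos a b k) := by
  by_cases h : Real.sin a - Real.sin b = 0
  · simp only [h, zero_div]; exact continuous_const
  refine continuous_const.div (continuous_const.sub (continuous_gcos a b)) fun k hk => h ?_
  have ha := Real.sin_sq_add_cos_sq a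
  have hb := Real.sin_sq_add_cos_sq b
  have hc := Real.cos_sq_le_one k
  have h1 : (Real.cos a * Real.cos b * Real.cos k) ^ 2 = (1 - Real.sin a * Real.sin b) ^ 2 := by
    unfold gcos at hk
    rw [show Real.cos a * Real.cos b * Real.cos k = (1 - Real.sin a * Real.sin b) by linarith]
  have h2 : (1 - Real.sin a * Real.sin b) ^ 2
      = (Real.cos a * Real.cos b) ^ 2 + (Real.sin a - Real.sin b) ^ 2 := by
    rw [mul_pow, eq_sub_of_add_eq' ha, eq_sub_of_add_eq' hb]; ring
  have h3 : (Real.cos a * Real.cos b * Real.cos k) ^ 2 ≤ (Real.cos a * Real.cos b) ^ 2 := by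
    rw [mul_pow]; exact mul_le_of_le_one_right (sq_nonneg _) hc
  nlinarith

lemma abs_vel_le (a b k : ℝ) : |vel a b k| ≤ |Real.cos a| := by
  rcases eq_or_ne (gsin a b k) 0 with h | h
  · simp [vel, h]
  have hg : 0 < gsin a b k := (gsin_nonneg a b k).lt_of_ne' h
  rw [vel, abs_div, abs_of_pos hg, div_le_iff₀ hg, mul_assoc, abs_mul]
  refine mul_le_mul_of_nonneg_left (abs_le_of_sq_le_sq ?_ hg.le) (abs_nonneg _)
  have := gsin_sq' a b k
  nlinarith [sq_nonneg (cross a b k)]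

lemma abs_cos_lt_one {a : ℝ} (ha : Real.sin a ≠ 0) : |Real.cos a| < 1 := by
  rw [← sq_lt_one_iff_abs_lt_one]
  have := Real.sin_sq_add_cos_sq a
  have : 0 < Real.sin a ^ 2 := by positivity
  linarith

lemma sin_pos_of_mem {k : ℝ} (hk : k ∈ Set.Ioo 0 Real.pi) : 0 < Real.sin k :=
  Real.sin_pos_of_pos_of_lt_pi hk.1 hk.2

lemma vel_mem_Ioo {a b k : ℝ} (ha : Real.sin a ≠ 0) : vel a b k ∈ Set.Ioo (-1 : ℝ) 1 :=
  abs_lt.1 ((abs_vel_le a b k).trans_lt (abs_cos_lt_one ha))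

lemma continuousOn_vel {a b : ℝ} (hb : Real.cos b ≠ 0) :
    ContinuousOn (vel a b) (Set.Ioo 0 Real.pi) := by
  unfold vel
  exact ContinuousOn.div (by fun_prop) (continuous_gsin a b).continuousOn
    fun k hk => (gsin_pos hb (sin_pos_of_mem hk).ne').ne'

lemma exists_bound_comp_vel {a b : ℝ} (ha : Real.sin a ≠ 0) {F : ℝ → ℝ}
    (hF : ContinuousOn F (Set.Ioo (-1) 1)) : ∃ K, ∀ k, ‖F (vel a b k)‖ ≤ K := by
  have h1 := abs_cos_lt_one ha
  obtain ⟨K, hK⟩ := isCompact_Icc.exists_bound_of_continuousOn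
    (hF.mono (Set.Icc_subset_Ioo (neg_lt_neg h1) h1))
  exact ⟨K, fun k => hK _ (abs_le.1 (abs_vel_le a b k))⟩

lemma integrableOn_comp_vel_mul {a b : ℝ} (ha : Real.sin a ≠ 0) (hb : Real.cos b ≠ 0) {F g : ℝ → ℝ}
    (hF : ContinuousOn F (Set.Ioo (-1) 1)) (hg : IntegrableOn g (Set.Ioo 0 Real.pi)) :
    IntegrableOn (fun k => F (vel a b k) * g k) (Set.Ioo 0 Real.pi) := by
  obtain ⟨K, hK⟩ := exists_bound_comp_vel (b := b) ha hF
  refine Integrable.bdd_mul (c := K) hg ?_ (Eventually.of_forall hK)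
  exact (hF.comp (continuousOn_vel hb) fun k _ => vel_mem_Ioo ha).aestronglyMeasurable
    measurableSet_Ioo

lemma integrableOn_dang {a b : ℝ} (hb : Real.cos b ≠ 0) :
    IntegrableOn (dang a b) (Set.Ioo 0 Real.pi) := by
  have h : Continuous fun k => ((Real.sin a + Real.sin b) / (1 + gcos a b k)
      + (Real.sin a - Real.sin b) / (1 - gcos a b k)) / 2 :=
    ((continuous_div_one_add_gcos a b).add (continuous_div_one_sub_gcos a b)).div_const 2
  refine (h.integrableOn_Icc.mono_set Set.Ioo_subset_Icc_self).congr_fun (fun k hk => ?_)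
    measurableSet_Ioo
  exact (dang_eq hb (sin_pos_of_mem hk).ne').symm

lemma even_eq_of_sq_eq {F : ℝ → ℝ} (he : ∀ y, F (-y) = F y) {x y : ℝ} (h : x ^ 2 = y ^ 2) :
    F x = F y := by
  rcases sq_eq_sq_iff_eq_or_eq_neg.1 h with rfl | rfl
  · rfl
  · exact he y

/-- The difference of the limits of `ang a b` at `π` and at `0`, in quarter turns, with the sign of
`cos b`. -/
def winding (a b : ℝ) : ℝ :=
  Real.sign (Real.cos b) * (Real.sign (Real.sin (b + a)) - Real.sign (Real.sin (b - a)))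

/-- The substitution `φ = ang a b k` in the integral of an even function of the velocity. The angle
need not be monotone, so a primitive in `φ` is used, and only the end values of `φ` matter. -/
lemma integral_mul_dang {a b : ℝ} (ha : Real.sin a ≠ 0) (hb : Real.cos b ≠ 0) {F : ℝ → ℝ}
    (hF : ContinuousOn F (Set.Ioo (-1) 1)) (he : ∀ y, F (-y) = F y) :
    ∫ k in (0)..Real.pi, F (vel a b k) * dang a b k
      = winding a b * ∫ t in (0)..(Real.pi / 2), F (Real.cos a * Real.cos t) := by
  have hcont : Continuous fun t => F (Real.cos a * Real.cos t) := by
    refine hF.comp_continuous (by fun_prop) fun t => abs_lt.1 ?_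
    rw [abs_mul]
    exact (mul_le_of_le_one_right (abs_nonneg _) (Real.abs_cos_le_one t)).trans_lt
      (abs_cos_lt_one ha)
  set P : ℝ → ℝ := fun u => ∫ t in (0)..u, F (Real.cos a * Real.cos t) with hP
  have hPd : ∀ u, HasDerivAt P (F (Real.cos a * Real.cos u)) u := fun u =>
    intervalIntegral.integral_hasDerivAt_right (hcont.intervalIntegrable _ _)
      (hcont.stronglyMeasurableAtFilter _ _) hcont.continuousAt
  have hPneg : ∀ u, P (-u) = -P u := by
    intro u
    have := intervalIntegral.integral_comp_neg (a := 0) (b := u)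
      (fun t => F (Real.cos a * Real.cos t))
    simp only [Real.cos_neg, neg_zero] at this
    simp only [hP]
    rw [this, intervalIntegral.integral_symm]
  have hPs : ∀ x, P (Real.arcsin (Real.sign x)) = Real.sign x * P (Real.pi / 2) := by
    intro x
    have h0 : P 0 = 0 := by simp [hP]
    rcases Real.sign_apply_eq x with h | h | h <;> rw [h]
    · rw [Real.arcsin_neg_one, hPneg]; ring
    · rw [Real.arcsin_zero, h0]; ring
    · rw [Real.arcsin_one]; ring
  have hss : Real.sign (Real.cos b) * Real.sign (Real.cos b) = 1 := by
    rcases Real.sign_apply_eq_of_ne_zero _ hb with h | h <;> rw [h] <;> norm_num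
  have hint := (integrableOn_comp_vel_mul ha hb hF (integrableOn_dang (a := a) hb)).const_mul
    (Real.sign (Real.cos b))
  have hside : ∀ k₀ ∈ ({0, Real.pi} : Set ℝ), ∀ l : Filter ℝ, l ≤ 𝓝 k₀ →
      (∀ᶠ k in l, k ∈ Set.Ioo 0 Real.pi) →
      Tendsto (fun k => P (ang a b k)) l (𝓝 (Real.sign (cross a b k₀) * P (Real.pi / 2))) := by
    intro k₀ hk₀ l hl hm
    rw [← hPs]
    refine ((hPd _).continuousAt.tendsto).comp (tendsto_ang hb ?_ hl ?_)
    · rcases hk₀ with rfl | rfl <;> simp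
    · filter_upwards [hm] with k hk using (sin_pos_of_mem hk).ne'
  have key := intervalIntegral.integral_eq_sub_of_hasDerivAt_of_tendsto (a := 0) (b := Real.pi)
    Real.pi_pos (f := fun k => P (ang a b k))
    (f' := fun k => Real.sign (Real.cos b) * (F (vel a b k) * dang a b k))
    (fun k hk => by
      refine ((hPd _).comp k (hasDerivAt_ang hb (sin_pos_of_mem hk))).congr_deriv ?_
      rw [even_eq_of_sq_eq he (vel_sq_eq hb (sin_pos_of_mem hk))]
      ring)
    (by rw [intervalIntegrable_iff_integrableOn_Ioo_of_le Real.pi_pos.le]; exact hint)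
    (hside 0 (by simp) _ nhdsWithin_le_nhds (Ioo_mem_nhdsGT Real.pi_pos))
    (hside Real.pi (by simp) _ nhdsWithin_le_nhds (Ioo_mem_nhdsLT Real.pi_pos))
  rw [intervalIntegral.integral_const_mul] at key
  have e0 : cross a b 0 = Real.sin (b - a) := by rw [Real.sin_sub]; simp [cross]
  have e1 : cross a b Real.pi = Real.sin (b + a) := by rw [Real.sin_add]; simp [cross]
  rw [e0, e1] at key
  rw [winding, mul_assoc, sub_mul, ← key, ← mul_assoc, hss, one_mul]

/-! ### Averages of even functions of the velocity -/

lemma sign_mul (x y : ℝ) : Real.sign (x * y) = Real.sign x * Real.sign y := by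
  rcases lt_trichotomy x 0 with hx | rfl | hx <;> rcases lt_trichotomy y 0 with hy | rfl | hy
  · rw [Real.sign_of_neg hx, Real.sign_of_neg hy, Real.sign_of_pos (mul_pos_of_neg_of_neg hx hy)]
    norm_num
  · simp
  · rw [Real.sign_of_neg hx, Real.sign_of_pos hy, Real.sign_of_neg (mul_neg_of_neg_of_pos hx hy)]
    norm_num
  · simp
  · simp
  · simp
  · rw [Real.sign_of_pos hx, Real.sign_of_neg hy, Real.sign_of_neg (mul_neg_of_pos_of_neg hx hy)]
    norm_num
  · simp
  · rw [Real.sign_of_pos hx, Real.sign_of_pos hy, Real.sign_of_pos (mul_pos hx hy)]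
    norm_num

lemma sign_add_of_abs_lt {x y : ℝ} (h : |x| < |y|) : Real.sign (x + y) = Real.sign y := by
  have h1 := neg_abs_le x
  have h2 := le_abs_self x
  rcases lt_trichotomy y 0 with hy | rfl | hy
  · rw [abs_of_neg hy] at h
    rw [Real.sign_of_neg hy, Real.sign_of_neg (by linarith)]
  · simp at h; exact absurd h (abs_nonneg x).not_gt
  · rw [abs_of_pos hy] at h
    rw [Real.sign_of_pos hy, Real.sign_of_pos (by linarith)]

lemma sign_mul_sign {x : ℝ} (hx : x ≠ 0) : Real.sign x * Real.sign x = 1 := by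
  rcases Real.sign_apply_eq_of_ne_zero _ hx with h | h <;> rw [h] <;> norm_num

/-- The angle attached to the smaller cosine runs over a half turn, the other one returns to its
starting value. -/
lemma winding_of_lt {a b : ℝ} (h : |Real.cos a| < |Real.cos b|) :
    winding a b = 2 * Real.sign (Real.sin a) ∧ winding b a = 0 := by
  have hb : Real.cos b ≠ 0 := abs_pos.1 ((abs_nonneg _).trans_lt h)
  have hab : |Real.sin b| < |Real.sin a| := by
    rw [← sq_lt_sq] at h ⊢
    have := Real.sin_sq_add_cos_sq a
    have := Real.sin_sq_add_cos_sq b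
    linarith
  have hs : |Real.sin b * Real.cos a| < |Real.cos b * Real.sin a| := by
    rw [abs_mul, abs_mul, mul_comm |Real.cos b|]
    exact mul_lt_mul'' hab h (abs_nonneg _) (abs_nonneg _)
  have e1 : Real.sign (Real.sin (b + a)) = Real.sign (Real.cos b) * Real.sign (Real.sin a) := by
    rw [Real.sin_add, sign_add_of_abs_lt hs, sign_mul]
  have e2 : Real.sign (Real.sin (b - a)) = -(Real.sign (Real.cos b) * Real.sign (Real.sin a)) := by
    rw [Real.sin_sub, sub_eq_add_neg, sign_add_of_abs_lt (by rwa [abs_neg]), Real.sign_neg,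
      sign_mul]
  have hbb := sign_mul_sign hb
  constructor
  · rw [winding, e1, e2]
    linear_combination 2 * Real.sign (Real.sin a) * hbb
  · rw [winding, add_comm a b, ← neg_sub b a, Real.sin_neg, Real.sign_neg, e1, e2]
    ring

/-- In the borderline case both angles run over a quarter turn. -/
lemma winding_of_eq {a b : ℝ} (ha : Real.cos a ≠ 0) (h : |Real.cos a| = |Real.cos b|) :
    winding a b = Real.sign (Real.sin a) := by
  have hs : |Real.sin a| = |Real.sin b| := by
    rw [← sq_eq_sq_iff_abs_eq_abs] at h ⊢
    have := Real.sin_sq_add_cos_sq a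
    have := Real.sin_sq_add_cos_sq b
    linarith
  have h2 : Real.sign 2 = 1 := Real.sign_of_pos (by norm_num)
  have haa := sign_mul_sign ha
  rw [winding, Real.sin_add, Real.sin_sub]
  rcases abs_eq_abs.1 h.symm with hc | hc <;> rcases abs_eq_abs.1 hs.symm with hd | hd <;>
    rw [hc, hd]
  · rw [show Real.sin a * Real.cos a + Real.cos a * Real.sin a
        = 2 * (Real.cos a * Real.sin a) by ring,
      show Real.sin a * Real.cos a - Real.cos a * Real.sin a = 0 by ring, sign_mul, sign_mul, h2,
      Real.sign_zero]
    linear_combination Real.sign (Real.sin a) * haa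
  · rw [show -Real.sin a * Real.cos a + Real.cos a * Real.sin a = 0 by ring,
      show -Real.sin a * Real.cos a - Real.cos a * Real.sin a
        = -(2 * (Real.cos a * Real.sin a)) by ring,
      Real.sign_neg, sign_mul, sign_mul, h2, Real.sign_zero]
    linear_combination Real.sign (Real.sin a) * haa
  · rw [show Real.sin a * Real.cos a + -Real.cos a * Real.sin a = 0 by ring,
      show Real.sin a * Real.cos a - -Real.cos a * Real.sin a
        = 2 * (Real.cos a * Real.sin a) by ring,
      Real.sign_neg, sign_mul, sign_mul, h2, Real.sign_zero]
    linear_combination Real.sign (Real.sin a) * haa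
  · rw [show -Real.sin a * Real.cos a + -Real.cos a * Real.sin a
        = -(2 * (Real.cos a * Real.sin a)) by ring,
      show -Real.sin a * Real.cos a - -Real.cos a * Real.sin a = 0 by ring,
      Real.sign_neg, Real.sign_neg, sign_mul, sign_mul, h2, Real.sign_zero]
    linear_combination Real.sign (Real.sin a) * haa

/-- The product of the imaginary parts of `axisOff a b k` and `axisOff b a k`. -/
def wprod (a b k : ℝ) : ℝ := cross a b k * cross b a k / gsin a b k ^ 2

lemma wprod_comm (a b k : ℝ) : wprod b a k = wprod a b k := by
  rw [wprod, wprod, gsin_comm]; ring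

lemma one_sub_vel_sq {a b k : ℝ} (hb : Real.cos b ≠ 0) (hk : Real.sin k ≠ 0) :
    1 - vel a b k ^ 2 = Real.sin a * dang a b k + Real.sin b * dang b a k := by
  have hg := gsin_pos (a := a) hb hk
  have h := gsin_sq' a b k
  have ha := Real.sin_sq_add_cos_sq a
  have hkk := Real.sin_sq_add_cos_sq k
  rw [vel, dang, dang, gsin_comm a b]
  field_simp
  rw [h]
  unfold cross
  linear_combination Real.cos b ^ 2 * Real.sin a ^ 2 * hkk - Real.cos b ^ 2 * Real.sin k ^ 2 * ha

lemma cos_sq_sub_vel_sq {a b k : ℝ} (hb : Real.cos b ≠ 0) (hk : Real.sin k ≠ 0) :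
    Real.cos a ^ 2 - vel a b k ^ 2 = Real.cos a ^ 2 * cross a b k ^ 2 / gsin a b k ^ 2 := by
  have hg := gsin_pos (a := a) hb hk
  have h := gsin_sq' a b k
  rw [vel]
  field_simp
  rw [h]
  ring

lemma wprod_mul_one_sub_vel_sq {a b k : ℝ} (ha : Real.cos a ≠ 0) (hb : Real.cos b ≠ 0)
    (hk : Real.sin k ≠ 0) :
    Real.cos a * Real.cos b * (wprod a b k * (1 - vel a b k ^ 2))
      = Real.sin b * (Real.cos a ^ 2 - vel a b k ^ 2) * dang a b k
        + Real.sin a * (Real.cos b ^ 2 - vel a b k ^ 2) * dang b a k := by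
  have h2 := cos_sq_sub_vel_sq (a := b) ha hk
  rw [vel_comm, gsin_comm] at h2
  rw [one_sub_vel_sq hb hk, cos_sq_sub_vel_sq hb hk, h2, wprod, dang, dang, gsin_comm]
  ring

lemma wprod_add {a b k : ℝ} (hb : Real.cos b ≠ 0) (hk : Real.sin k ≠ 0) :
    Real.cos a * Real.cos b * wprod a b k + Real.sin a * Real.sin b
      = Real.sin b * dang a b k + Real.sin a * dang b a k := by
  have hg := gsin_pos (a := a) hb hk
  have h := gsin_sq a b k
  have ha := Real.sin_sq_add_cos_sq a
  have hb := Real.sin_sq_add_cos_sq b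
  rw [wprod, dang, dang, gsin_comm a b]
  field_simp
  rw [h]
  unfold cross gcos
  grind

lemma integral_congr_Ioo {f g : ℝ → ℝ} (h : ∀ k ∈ Set.Ioo 0 Real.pi, f k = g k) :
    ∫ k in (0)..Real.pi, f k = ∫ k in (0)..Real.pi, g k := by
  rw [intervalIntegral.integral_of_le Real.pi_pos.le,
    intervalIntegral.integral_of_le Real.pi_pos.le,
    integral_Ioc_eq_integral_Ioo, integral_Ioc_eq_integral_Ioo]
  exact setIntegral_congr_fun measurableSet_Ioo h

lemma integral_dang_add {a b : ℝ} (ha : Real.sin a ≠ 0) (hb : Real.sin b ≠ 0) (ha' : Real.cos a ≠ 0)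
    (hb' : Real.cos b ≠ 0) {F G : ℝ → ℝ} (hF : ContinuousOn F (Set.Ioo (-1) 1))
    (hG : ContinuousOn G (Set.Ioo (-1) 1)) (heF : ∀ y, F (-y) = F y) (heG : ∀ y, G (-y) = G y) :
    ∫ k in (0)..Real.pi, (F (vel a b k) * dang a b k + G (vel a b k) * dang b a k)
      = winding a b * (∫ t in (0)..(Real.pi / 2), F (Real.cos a * Real.cos t))
        + winding b a * ∫ t in (0)..(Real.pi / 2), G (Real.cos b * Real.cos t) := by
  have h1 := integral_mul_dang ha hb' hF heF
  have h2 := integral_mul_dang hb ha' hG heG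
  simp only [vel_comm a b] at h2
  rw [← h1, ← h2, intervalIntegral.integral_add]
  · rw [intervalIntegrable_iff_integrableOn_Ioo_of_le Real.pi_pos.le]
    exact integrableOn_comp_vel_mul ha hb' hF (integrableOn_dang hb')
  · rw [intervalIntegrable_iff_integrableOn_Ioo_of_le Real.pi_pos.le]
    exact integrableOn_comp_vel_mul ha hb' hG (integrableOn_dang ha')

/-- The angle integrals attached to `a` and `b` combine into a single one over a quarter turn,
attached to the smaller cosine: either only this angle winds, or `|cos a| = |cos b|`, the two
integrals agree and each angle winds half as much. The parameter `r` of `F` stands for `cos² a` or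
`cos² b`. -/
lemma integral_dang_combination {a b : ℝ} (ha : Real.sin a ≠ 0) (hb : Real.sin b ≠ 0)
    (ha' : Real.cos a ≠ 0) (hb' : Real.cos b ≠ 0) (hab : |Real.cos a| ≤ |Real.cos b|)
    {F : ℝ → ℝ → ℝ}
    (hF : ∀ r, ContinuousOn (F r) (Set.Ioo (-1) 1)) (he : ∀ r y, F r (-y) = F r y) :
    (∫ k in (0)..Real.pi, (Real.sin a * F (Real.cos a ^ 2) (vel a b k) * dang a b k
        + Real.sin b * F (Real.cos b ^ 2) (vel a b k) * dang b a k)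
      = 2 * |Real.sin a|
        * ∫ t in (0)..(Real.pi / 2), F (Real.cos a ^ 2) (Real.cos a * Real.cos t)) ∧
    (∫ k in (0)..Real.pi, (Real.sin b * F (Real.cos a ^ 2) (vel a b k) * dang a b k
        + Real.sin a * F (Real.cos b ^ 2) (vel a b k) * dang b a k)
      = 2 * |Real.sin a| * (Real.sin b / Real.sin a)
        * ∫ t in (0)..(Real.pi / 2), F (Real.cos a ^ 2) (Real.cos a * Real.cos t)) := by
  have key : ∀ α β : ℝ, ∫ k in (0)..Real.pi, (α * F (Real.cos a ^ 2) (vel a b k) * dang a b k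
        + β * F (Real.cos b ^ 2) (vel a b k) * dang b a k)
      = winding a b * (α * ∫ t in (0)..(Real.pi / 2), F (Real.cos a ^ 2) (Real.cos a * Real.cos t))
        + winding b a * (β * ∫ t in (0)..(Real.pi / 2),
            F (Real.cos b ^ 2) (Real.cos b * Real.cos t)) := by
    intro α β
    rw [← intervalIntegral.integral_const_mul α, ← intervalIntegral.integral_const_mul β]
    exact integral_dang_add ha hb ha' hb' (F := fun y => α * F (Real.cos a ^ 2) y)
      (G := fun y => β * F (Real.cos b ^ 2) y) (continuousOn_const.mul (hF _))
      (continuousOn_const.mul (hF _)) (fun y => by simp only [he]) (fun y => by simp only [he])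
  rw [key, key]
  have hsa := sign_mul_self (Real.sin a)
  have hsb := sign_mul_self (Real.sin b)
  generalize hJ : ∫ t in (0)..(Real.pi / 2), F (Real.cos a ^ 2) (Real.cos a * Real.cos t) = J
  rcases hab.lt_or_eq with h | h
  · obtain ⟨h1, h2⟩ := winding_of_lt h
    rw [h1, h2]
    constructor
    · linear_combination 2 * J * hsa
    · field_simp
      linear_combination 2 * Real.sin b * J * hsa
  · have hc2 : Real.cos b ^ 2 = Real.cos a ^ 2 := ((sq_eq_sq_iff_abs_eq_abs _ _).2 h).symm
    have hs : |Real.sin b| = |Real.sin a| := by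
      rw [← sq_eq_sq_iff_abs_eq_abs]
      have := Real.sin_sq_add_cos_sq a
      have := Real.sin_sq_add_cos_sq b
      linarith
    have hJ' : ∫ t in (0)..(Real.pi / 2), F (Real.cos b ^ 2) (Real.cos b * Real.cos t) = J := by
      rw [← hJ, hc2]
      refine intervalIntegral.integral_congr fun t _ => even_eq_of_sq_eq (he _) ?_
      rw [mul_pow, mul_pow, hc2]
    rw [winding_of_eq ha' h, winding_of_eq hb' h.symm, hJ']
    constructor
    · linear_combination J * hsa + J * hsb + J * hs
    · have hss : Real.sin b ^ 2 = Real.sin a ^ 2 := (sq_eq_sq_iff_abs_eq_abs _ _).2 hs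
      have hsb2 : Real.sign (Real.sin b) * Real.sin a ^ 2 = |Real.sin a| * Real.sin b := by
        rw [← hss, ← hs, ← hsb]; ring
      field_simp
      linear_combination Real.sin b * J * hsa + J * hsb2

lemma integral_mul_one_sub_vel_sq
    {a b : ℝ} (ha : Real.sin a ≠ 0) (hb : Real.sin b ≠ 0)
    (ha' : Real.cos a ≠ 0) (hb' : Real.cos b ≠ 0) (hab : |Real.cos a| ≤ |Real.cos b|) {F : ℝ → ℝ}
    (hF : ContinuousOn F (Set.Ioo (-1) 1)) (he : ∀ y, F (-y) = F y) :
    ∫ k in (0)..Real.pi, F (vel a b k) * (1 - vel a b k ^ 2)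
      = 2 * |Real.sin a| * ∫ t in (0)..(Real.pi / 2), F (Real.cos a * Real.cos t) := by
  rw [← (integral_dang_combination ha hb ha' hb' hab (F := fun _ => F) (fun _ => hF)
    (fun _ => he)).1]
  refine integral_congr_Ioo fun k hk => ?_
  rw [one_sub_vel_sq hb' (sin_pos_of_mem hk).ne']
  ring

lemma integral_mul_wprod
    {a b : ℝ} (ha : Real.sin a ≠ 0) (hb : Real.sin b ≠ 0)
    (ha' : Real.cos a ≠ 0) (hb' : Real.cos b ≠ 0) (hab : |Real.cos a| ≤ |Real.cos b|) {F : ℝ → ℝ}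
    (hF : ContinuousOn F (Set.Ioo (-1) 1)) (he : ∀ y, F (-y) = F y) :
    Real.cos a * Real.cos b * ∫ k in (0)..Real.pi, F (vel a b k) * (1 - vel a b k ^ 2) * wprod a b k
      = 2 * |Real.sin a| * (Real.sin b / Real.sin a)
        * ∫ t in (0)..(Real.pi / 2), F (Real.cos a * Real.cos t)
            * (Real.cos a ^ 2 - (Real.cos a * Real.cos t) ^ 2) := by
  rw [← (integral_dang_combination ha hb ha' hb' hab (F := fun r y => F y * (r - y ^ 2))
    (fun r => hF.mul (by fun_prop)) (fun r y => by simp only [he, neg_sq])).2,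
    ← intervalIntegral.integral_const_mul]
  refine integral_congr_Ioo fun k hk => ?_
  linear_combination F (vel a b k) * wprod_mul_one_sub_vel_sq ha' hb' (sin_pos_of_mem hk).ne'

lemma integral_mul_wprod_add
    {a b : ℝ} (ha : Real.sin a ≠ 0) (hb : Real.sin b ≠ 0)
    (ha' : Real.cos a ≠ 0) (hb' : Real.cos b ≠ 0) (hab : |Real.cos a| ≤ |Real.cos b|) {F : ℝ → ℝ}
    (hF : ContinuousOn F (Set.Ioo (-1) 1)) (he : ∀ y, F (-y) = F y) :
    ∫ k in (0)..Real.pi, F (vel a b k)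
        * (Real.cos a * Real.cos b * wprod a b k + Real.sin a * Real.sin b)
      = 2 * |Real.sin a| * (Real.sin b / Real.sin a)
        * ∫ t in (0)..(Real.pi / 2), F (Real.cos a * Real.cos t) := by
  rw [← (integral_dang_combination ha hb ha' hb' hab (F := fun _ => F) (fun _ => hF)
    (fun _ => he)).2]
  refine integral_congr_Ioo fun k hk => ?_
  rw [wprod_add hb' (sin_pos_of_mem hk).ne']
  ring

/-! ### The atom and the folded quadratic form in closed form -/

section

open Complex ComplexConjugate

lemma c_sq (θ : Fin 2 → ℝ) (i : Fin 2) : c θ i ^ 2 = (1 - s θ i) * (1 + s θ i) := by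
  have := Real.sin_sq_add_cos_sq (θ i)
  unfold c s; linear_combination this

lemma one_sub_s_ne {θ : Fin 2 → ℝ} {i : Fin 2} (h : c θ i ≠ 0) : 1 - s θ i ≠ 0 := by
  have := c_sq θ i
  exact left_ne_zero_of_mul (this ▸ pow_ne_zero 2 h)

lemma one_add_s_ne {θ : Fin 2 → ℝ} {i : Fin 2} (h : c θ i ≠ 0) : 1 + s θ i ≠ 0 := by
  have := c_sq θ i
  exact right_ne_zero_of_mul (this ▸ pow_ne_zero 2 h)

lemma inv_ν₁ {θ : Fin 2 → ℝ} (hc : ∀ i, c θ i ≠ 0) :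
    (ν₁ θ)⁻¹ = (1 - s θ 0) * (1 + s θ 1) / (c θ 0 * c θ 1) := by
  have h0 := c_sq θ 0
  have h1 := c_sq θ 1
  have := hc 0; have := hc 1
  have := one_add_s_ne (hc 0); have := one_sub_s_ne (hc 1)
  rw [ν₁, inv_div]
  field_simp
  rw [h0, h1]; ring

lemma inv_ν₂ {θ : Fin 2 → ℝ} (hc : ∀ i, c θ i ≠ 0) :
    (ν₂ θ)⁻¹ = -((1 - s θ 0) * (1 - s θ 1) / (c θ 0 * c θ 1)) := by
  have h0 := c_sq θ 0
  have h1 := c_sq θ 1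
  have := hc 0; have := hc 1
  have := one_add_s_ne (hc 0); have := one_add_s_ne (hc 1)
  rw [ν₂, inv_neg, inv_div]
  field_simp
  rw [h0, h1]; ring

lemma inv_one_sub_s {θ : Fin 2 → ℝ} {i : Fin 2} (h : c θ i ≠ 0) :
    1 / (1 - s θ i) = (1 + s θ i) / c θ i ^ 2 := by
  have := one_sub_s_ne h; have := one_add_s_ne h
  rw [c_sq]; field_simp

lemma inv_one_add_s {θ : Fin 2 → ℝ} {i : Fin 2} (h : c θ i ≠ 0) :
    1 / (1 + s θ i) = (1 - s θ i) / c θ i ^ 2 := by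
  have := one_sub_s_ne h; have := one_add_s_ne h
  rw [c_sq]; field_simp

lemma sub_mul_ind_lt (x y : ℝ) : (x - y) * ind (x < y) = ((x - y) - |x - y|) / 2 := by
  rcases lt_or_ge x y with h | h
  · rw [ind, if_pos h, abs_of_neg (by linarith)]; ring
  · rw [ind, if_neg h.not_gt, abs_of_nonneg (by linarith)]; ring

lemma sub_mul_ind_gt (x y : ℝ) : (x - y) * ind (x > y) = ((x - y) + |x - y|) / 2 := by
  rcases lt_or_ge y x with h | h
  · rw [ind, if_pos h, abs_of_pos (by linarith)]; ring
  · rw [ind, if_neg h.not_gt, abs_of_nonpos (by linarith)]; ring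

lemma add_mul_ind_lt (x y : ℝ) : (x + y) * ind (x < -y) = ((x + y) - |x + y|) / 2 := by
  simpa using sub_mul_ind_lt x (-y)

lemma add_mul_ind_gt (x y : ℝ) : (x + y) * ind (x > -y) = ((x + y) + |x + y|) / 2 := by
  simpa using sub_mul_ind_gt x (-y)

lemma η₁_zero (θ : Fin 2 → ℝ) : η₁ θ 0 = (|s θ 0 - s θ 1| + |s θ 0 + s θ 1|) / 4 := by
  simp only [η₁, abs_zero, neg_zero, zpow_zero, one_mul]
  linear_combination (-1 / 4) * sub_mul_ind_lt (s θ 0) (s θ 1)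
    + (1 / 4) * sub_mul_ind_gt (s θ 0) (s θ 1) - (1 / 4) * add_mul_ind_lt (s θ 0) (s θ 1)
    + (1 / 4) * add_mul_ind_gt (s θ 0) (s θ 1)

lemma η₁_one {θ : Fin 2 → ℝ} (hc : ∀ i, c θ i ≠ 0) :
    η₁ θ 1 = (4 * (s θ 0 * s θ 1) + |s θ 0 - s θ 1| * (1 - s θ 0 * s θ 1)
      - |s θ 0 + s θ 1| * (1 + s θ 0 * s θ 1)) / (4 * (c θ 0 * c θ 1)) := by
  have h0 := hc 0
  have h1 := hc 1
  simp only [η₁, abs_one, zpow_one, zpow_neg_one, inv_ν₁ hc, inv_ν₂ hc]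
  trans -(1 / 4) * (ν₁ θ * (((s θ 0 - s θ 1) - |s θ 0 - s θ 1|) / 2)
    - (1 - s θ 0) * (1 + s θ 1) / (c θ 0 * c θ 1) * (((s θ 0 - s θ 1) + |s θ 0 - s θ 1|) / 2)
    + (ν₂ θ * (((s θ 0 + s θ 1) - |s θ 0 + s θ 1|) / 2)
    - -((1 - s θ 0) * (1 - s θ 1) / (c θ 0 * c θ 1)) * (((s θ 0 + s θ 1) + |s θ 0 + s θ 1|) / 2)))
  · rw [← sub_mul_ind_lt, ← sub_mul_ind_gt, ← add_mul_ind_lt, ← add_mul_ind_gt]; ring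
  · rw [ν₁, ν₂]; field_simp; ring

lemma η₂_zero {θ : Fin 2 → ℝ} (hc : ∀ i, c θ i ≠ 0) :
    η₂ θ 0 = (|s θ 0 - s θ 1| * (1 + s θ 0 * s θ 1) - |s θ 0 + s θ 1| * (1 - s θ 0 * s θ 1))
      / (4 * (c θ 0 * c θ 1)) := by
  have h0 := hc 0
  have h1 := hc 1
  simp only [η₂, le_refl, if_true, neg_zero, zpow_zero, mul_one, inv_ν₁ hc, inv_ν₂ hc]
  trans (1 / 4) * (ν₂ θ * (((s θ 0 - s θ 1) - |s θ 0 - s θ 1|) / 2)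
    - -((1 - s θ 0) * (1 - s θ 1) / (c θ 0 * c θ 1)) * (((s θ 0 - s θ 1) + |s θ 0 - s θ 1|) / 2)
    + (ν₁ θ * (((s θ 0 + s θ 1) - |s θ 0 + s θ 1|) / 2)
    - (1 - s θ 0) * (1 + s θ 1) / (c θ 0 * c θ 1) * (((s θ 0 + s θ 1) + |s θ 0 + s θ 1|) / 2)))
  · rw [← sub_mul_ind_lt, ← sub_mul_ind_gt, ← add_mul_ind_lt, ← add_mul_ind_gt]; ring
  · rw [ν₁, ν₂]; field_simp; ring

lemma η₃_zero {θ : Fin 2 → ℝ} (hc : ∀ i, c θ i ≠ 0) :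
    η₃ θ 0 = s θ 0 * (2 - |s θ 0 - s θ 1| - |s θ 0 + s θ 1|) / (4 * c θ 0) := by
  have h0 := hc 0
  simp only [η₃, le_refl, if_true, neg_zero, zpow_zero, mul_one, inv_one_sub_s (hc 0),
    inv_one_add_s (hc 0)]
  trans (c θ 0 / 4) * ((1 + s θ 0) / c θ 0 ^ 2 * (((s θ 0 - s θ 1) - |s θ 0 - s θ 1|) / 2)
    + (1 - s θ 0) / c θ 0 ^ 2 * (((s θ 0 - s θ 1) + |s θ 0 - s θ 1|) / 2)
    + ((1 + s θ 0) / c θ 0 ^ 2 * (((s θ 0 + s θ 1) - |s θ 0 + s θ 1|) / 2)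
    + (1 - s θ 0) / c θ 0 ^ 2 * (((s θ 0 + s θ 1) + |s θ 0 + s θ 1|) / 2)))
  · rw [← sub_mul_ind_lt, ← sub_mul_ind_gt, ← add_mul_ind_lt, ← add_mul_ind_gt]; ring
  · field_simp; ring

lemma η₃_neg_one {θ : Fin 2 → ℝ} (hc : ∀ i, c θ i ≠ 0) :
    η₃ θ (-1) = s θ 1 * (2 - |s θ 0 - s θ 1| - |s θ 0 + s θ 1|) / (4 * c θ 1) := by
  have h0 := hc 0
  have h1 := hc 1
  have h2 := one_add_s_ne (hc 0)
  have h3 := one_sub_s_ne (hc 0)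
  have hn : ¬ (0 : ℤ) ≤ -1 := by norm_num
  simp only [η₃, hn, if_false, neg_neg, zpow_one, zpow_neg_one, inv_ν₁ hc, inv_ν₂ hc]
  trans -(c θ 0 / 4) * (1 / (1 + s θ 0) * ν₁ θ * (((s θ 0 - s θ 1) - |s θ 0 - s θ 1|) / 2)
    + 1 / (1 - s θ 0) * ((1 - s θ 0) * (1 + s θ 1) / (c θ 0 * c θ 1))
      * (((s θ 0 - s θ 1) + |s θ 0 - s θ 1|) / 2)
    + (1 / (1 + s θ 0) * ν₂ θ * (((s θ 0 + s θ 1) - |s θ 0 + s θ 1|) / 2)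
    + 1 / (1 - s θ 0) * -((1 - s θ 0) * (1 - s θ 1) / (c θ 0 * c θ 1))
      * (((s θ 0 + s θ 1) + |s θ 0 + s θ 1|) / 2)))
  · rw [← sub_mul_ind_lt, ← sub_mul_ind_gt, ← add_mul_ind_lt, ← add_mul_ind_gt]; ring
  · rw [ν₁, ν₂]; field_simp; ring

/-- Half the coefficient of `vel ^ 2` in `corr`. -/
def velCoef (θ : Fin 2 → ℝ) (q : Fin 4 → ℂ) : ℝ :=
  1 / 2 * (‖q 0‖ ^ 2 - ‖q 1‖ ^ 2 - ‖q 2‖ ^ 2 + ‖q 3‖ ^ 2)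
    + s θ 0 / c θ 0 * (cr q 0 1 - cr q 2 3) + s θ 1 / c θ 1 * (cr q 0 2 - cr q 1 3)
    + s θ 0 * s θ 1 / (c θ 0 * c θ 1) * (cr q 0 3 + cr q 1 2)

/-- The powers of `ν₁` and `ν₂` cancel: for the arguments occurring in `Δ`, the functions `η` are
elementary in `|s₁ - s₂|` and `|s₁ + s₂|`. -/
lemma atomMass_eq {θ : Fin 2 → ℝ} (hc : ∀ i, c θ i ≠ 0) (q : Fin 4 → ℂ)
    (hq : ∑ i, ‖q i‖ ^ 2 = 1) :
    atomMass θ q = 1 / 2 - velCoef θ q * (1 - (|s θ 0 - s θ 1| + |s θ 0 + s θ 1|) / 2)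
      - (cr q 1 2 - cr q 0 3)
        * ((|s θ 0 + s θ 1| - |s θ 0 - s θ 1|) / 2 - s θ 0 * s θ 1) / (c θ 0 * c θ 1) := by
  have h0 := hc 0
  have h1 := hc 1
  rw [Fin.sum_univ_four] at hq
  rw [atomMass, η₁_zero, η₁_one hc, η₂_zero hc, η₃_zero hc, η₃_neg_one hc, velCoef]
  have e : ‖q 1‖ ^ 2 = 1 - ‖q 0‖ ^ 2 - ‖q 2‖ ^ 2 - ‖q 3‖ ^ 2 := by linarith
  rw [e]
  field_simp
  ring

lemma d₂_eq (θ : Fin 2 → ℝ) (q : Fin 4 → ℂ) (m M : Fin 2) :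
    d₂ θ q m M = velCoef θ q - s θ M / (c θ 0 * c θ 1 * s θ m) * (cr q 1 2 - cr q 0 3) := by
  rw [d₂, velCoef]; ring

/-- The matrix `c - i s N` with `N = !![v, r + i y; r - i y, -v]`. -/
def phaseEntries (c s v r y : ℝ) : Matrix (Fin 2) (Fin 2) ℂ :=
  !![c - I * s * v, -(I * s * (r + I * y)); -(I * s * (r - I * y)), c + I * s * v]

/-- The expectation `⟨N ⊗ 1 + 1 ⊗ N'⟩` without its terms linear in the imaginary parts `y, y'`, for
`N = !![v, r + i y; r - i y, -v]` and `N' = !![v, r' + i y'; r' - i y', -v]`. -/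
def linForm (q : Fin 4 → ℂ) (v r r' : ℝ) : ℝ :=
  2 * (v * (‖q 0‖ ^ 2 - ‖q 3‖ ^ 2) + r' * (cr q 0 1 + cr q 2 3) + r * (cr q 0 2 + cr q 1 3))

/-- The part of the expectation `⟨N ⊗ N'⟩` that is even in `(y, y')`, for `N, N'` as in `linForm`;
it depends on `y` and `y'` only through `w = y y'`. -/
def quadForm (q : Fin 4 → ℂ) (v r r' w : ℝ) : ℝ :=
  v ^ 2 * (‖q 0‖ ^ 2 - ‖q 1‖ ^ 2 - ‖q 2‖ ^ 2 + ‖q 3‖ ^ 2)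
    + 2 * v * (r' * (cr q 0 1 - cr q 2 3) + r * (cr q 0 2 - cr q 1 3))
    + 2 * (r * r' - w) * cr q 0 3 + 2 * (r * r' + w) * cr q 1 2

lemma tensorForm_amp (q : Fin 4 → ℂ) (G H : Matrix (Fin 2) (Fin 2) ℂ) :
    tensorForm (amp q) G H =
      conj (q 0) * (G 0 0 * H 0 0 * q 0 + G 0 0 * H 0 1 * q 1 + G 0 1 * H 0 0 * q 2
        + G 0 1 * H 0 1 * q 3)
      + conj (q 1) * (G 0 0 * H 1 0 * q 0 + G 0 0 * H 1 1 * q 1 + G 0 1 * H 1 0 * q 2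
        + G 0 1 * H 1 1 * q 3)
      + conj (q 2) * (G 1 0 * H 0 0 * q 0 + G 1 0 * H 0 1 * q 1 + G 1 1 * H 0 0 * q 2
        + G 1 1 * H 0 1 * q 3)
      + conj (q 3) * (G 1 0 * H 1 0 * q 0 + G 1 0 * H 1 1 * q 1 + G 1 1 * H 1 0 * q 2
        + G 1 1 * H 1 1 * q 3) := by
  simp [tensorForm_eq_sum, amp, Fintype.sum_prod_type, Fin.sum_univ_two, add_assoc]

/-- Under `k ↦ -k` the entries `v, r, r'` change sign and `y, y'` do not, so folding removes the
terms of the wrong parity. -/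
lemma tensorForm_fold (q : Fin 4 → ℂ) (hq : ∑ i, ‖q i‖ ^ 2 = 1) (c s v r y r' y' : ℝ) :
    tensorForm (amp q) (phaseEntries c s v r y) (phaseEntries c s v r' y')
      + tensorForm (amp q) (phaseEntries c (-s) (-v) (-r) y) (phaseEntries c (-s) (-v) (-r') y')
    = ((2 * (c ^ 2 - s ^ 2 * quadForm q v r r' (y * y')) : ℝ) : ℂ)
      - I * ((2 * c * s * linForm q v r r' : ℝ) : ℂ) := by
  rw [Fin.sum_univ_four] at hq
  simp only [← Complex.normSq_eq_norm_sq, Complex.normSq_apply] at hq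
  simp only [tensorForm_amp, phaseEntries, linForm, quadForm, cr, ← Complex.normSq_eq_norm_sq,
    Complex.normSq_apply]
  simp only [pow_two (M := ℝ)]
  apply Complex.ext <;> simp
  · linear_combination (2 * c ^ 2) * hq
  · ring

end

/-! ### The folded limit and its momentum integrals -/

section

open Complex ComplexConjugate

lemma vel_neg (a b k : ℝ) : vel a b (-k) = -vel a b k := by
  simp only [vel, gsin, gcos, Real.cos_neg, Real.sin_neg]; ring

lemma phaseMatrix_eq {a b : ℝ} (hb : Real.cos b ≠ 0) (ξ k : ℝ) :
    phaseMatrix ξ a b k = phaseEntries (Real.cos (ξ * vel a b k)) (Real.sin (ξ * vel a b k))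
      (vel a b k) (vel a b k * (Real.sin b / Real.cos b)) (cross b a k / gsin a b k) := by
  have : Real.cos a * Real.sin b * Real.sin k / gsin a b k
      = vel a b k * (Real.sin b / Real.cos b) := by
    rw [vel]; field_simp
  ext i j
  fin_cases i <;> fin_cases j <;>
    simp only [phaseMatrix, phaseEntries, axis, axisOff, this] <;>
    (simp [-ofReal_cos, -ofReal_sin]; try first | ring1 | (left; ring1))

lemma phaseMatrix_neg {a b : ℝ} (hb : Real.cos b ≠ 0) (ξ k : ℝ) :
    phaseMatrix ξ a b (-k) = phaseEntries (Real.cos (ξ * vel a b k)) (-Real.sin (ξ * vel a b k))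
      (-vel a b k) (-(vel a b k * (Real.sin b / Real.cos b))) (cross b a k / gsin a b k) := by
  have h1 : cross b a (-k) = cross b a k := by simp [cross]
  have h2 : gsin a b (-k) = gsin a b k := by simp [gsin, gcos]
  rw [phaseMatrix_eq hb, vel_neg, h1, h2, mul_neg, Real.cos_neg, Real.sin_neg, neg_mul]

lemma linForm_vel (θ : Fin 2 → ℝ) (q : Fin 4 → ℂ) (v : ℝ) :
    linForm q v (v * (s θ 1 / c θ 1)) (v * (s θ 0 / c θ 0)) = -(v * d₁ θ q) := by
  rw [linForm, d₁]; ring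

lemma quadForm_vel {θ : Fin 2 → ℝ} (hc : ∀ i, c θ i ≠ 0) (q : Fin 4 → ℂ) (v w : ℝ) :
    quadForm q v (v * (s θ 1 / c θ 1)) (v * (s θ 0 / c θ 0)) w
      = 2 * velCoef θ q * v ^ 2 + 2 * (cr q 1 2 - cr q 0 3) * w := by
  have := hc 0; have := hc 1
  rw [quadForm, velCoef]; field_simp; ring

/-- The even part in `k` of the expectation `⟨N ⊗ N'⟩`. -/
def corr (θ : Fin 2 → ℝ) (q : Fin 4 → ℂ) (k : ℝ) : ℝ :=
  2 * velCoef θ q * vel (θ 0) (θ 1) k ^ 2 + 2 * (cr q 1 2 - cr q 0 3) * wprod (θ 0) (θ 1) k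

/-- The part `1 - corr θ q k`, free of `ξ`, is the source of the atom. -/
lemma tensorForm_phaseMatrix_fold {θ : Fin 2 → ℝ} (hc : ∀ i, c θ i ≠ 0) (q : Fin 4 → ℂ)
    (hq : ∑ i, ‖q i‖ ^ 2 = 1) (ξ k : ℝ) :
    tensorForm (amp q) (phaseMatrix ξ (θ 0) (θ 1) k) (phaseMatrix ξ (θ 1) (θ 0) k)
      + tensorForm (amp q) (phaseMatrix ξ (θ 0) (θ 1) (-k)) (phaseMatrix ξ (θ 1) (θ 0) (-k))
    = ((1 - corr θ q k + Real.cos (2 * ξ * vel (θ 0) (θ 1) k) * (1 + corr θ q k) : ℝ) : ℂ)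
      + I * ((d₁ θ q * (Real.sin (2 * ξ * vel (θ 0) (θ 1) k) * vel (θ 0) (θ 1) k) : ℝ) : ℂ) := by
  rw [phaseMatrix_eq (hc 1), phaseMatrix_eq (hc 0), phaseMatrix_neg (hc 1), phaseMatrix_neg (hc 0),
    vel_comm (θ 0) (θ 1), gsin_comm (θ 0) (θ 1), tensorForm_fold q hq]
  have h1 := linForm_vel θ q (vel (θ 0) (θ 1) k)
  have h2 := quadForm_vel hc q (vel (θ 0) (θ 1) k)
  simp only [s, c] at h1 h2
  have hw : cross (θ 1) (θ 0) k / gsin (θ 0) (θ 1) k * (cross (θ 0) (θ 1) k / gsin (θ 0) (θ 1) k)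
      = wprod (θ 0) (θ 1) k := by rw [wprod]; ring
  rw [h1, h2, hw, ← corr]
  generalize vel (θ 0) (θ 1) k = v
  generalize corr θ q k = Q
  rw [show 2 * ξ * v = 2 * (ξ * v) by ring, Real.cos_two_mul, Real.sin_two_mul, Real.sin_sq]
  push_cast
  ring

lemma integrableOn_wprod {a b : ℝ} (ha' : Real.cos a ≠ 0) (hb' : Real.cos b ≠ 0) :
    IntegrableOn (wprod a b) (Set.Ioo 0 Real.pi) := by
  have h := (((integrableOn_dang (a := a) hb').const_mul (Real.sin b)).add
    ((integrableOn_dang (a := b) ha').const_mul (Real.sin a))).sub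
    (integrableOn_const (C := Real.sin a * Real.sin b) (s := Set.Ioo 0 Real.pi) (by simp))
    |>.const_mul (Real.cos a * Real.cos b)⁻¹
  refine IntegrableOn.congr_fun h (fun k hk => ?_) measurableSet_Ioo
  have := wprod_add (a := a) hb' (sin_pos_of_mem hk).ne'
  simp only [Pi.add_apply, Pi.sub_apply]
  rw [← this]
  field_simp
  ring

lemma intervalIntegrable_wprod {a b : ℝ} (ha' : Real.cos a ≠ 0) (hb' : Real.cos b ≠ 0) :
    IntervalIntegrable (wprod a b) volume 0 Real.pi := by
  rw [intervalIntegrable_iff_integrableOn_Ioo_of_le Real.pi_pos.le]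
  exact integrableOn_wprod ha' hb'

lemma one_sub_sq_pos {y : ℝ} (hy : y ∈ Set.Ioo (-1 : ℝ) 1) : 0 < 1 - y ^ 2 := by
  have := (sq_lt_one_iff_abs_lt_one y).2 (abs_lt.2 hy)
  linarith

lemma intervalIntegrable_vel_mul {a b : ℝ} (ha : Real.sin a ≠ 0) (hb' : Real.cos b ≠ 0)
    {F g : ℝ → ℝ}
    (hF : ContinuousOn F (Set.Ioo (-1) 1)) (hg : IntegrableOn g (Set.Ioo 0 Real.pi)) :
    IntervalIntegrable (fun k => F (vel a b k) * g k) volume 0 Real.pi := by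
  rw [intervalIntegrable_iff_integrableOn_Ioo_of_le Real.pi_pos.le]
  exact integrableOn_comp_vel_mul ha hb' hF hg

lemma intervalIntegrable_vel {a b : ℝ} (ha : Real.sin a ≠ 0) (hb' : Real.cos b ≠ 0) {F : ℝ → ℝ}
    (hF : ContinuousOn F (Set.Ioo (-1) 1)) :
    IntervalIntegrable (fun k => F (vel a b k)) volume 0 Real.pi := by
  simpa using intervalIntegrable_vel_mul (g := fun _ => 1) ha hb' hF
    (integrableOn_const (by simp))

lemma integral_vel {a b : ℝ} (ha : Real.sin a ≠ 0) (hb : Real.sin b ≠ 0)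
    (ha' : Real.cos a ≠ 0) (hb' : Real.cos b ≠ 0) (hab : |Real.cos a| ≤ |Real.cos b|) {F : ℝ → ℝ}
    (hF : ContinuousOn F (Set.Ioo (-1) 1)) (he : ∀ y, F (-y) = F y) :
    ∫ k in (0)..Real.pi, F (vel a b k)
      = 2 * |Real.sin a| * ∫ t in (0)..(Real.pi / 2),
          F (Real.cos a * Real.cos t) / (1 - (Real.cos a * Real.cos t) ^ 2) := by
  have h := integral_mul_one_sub_vel_sq ha hb ha' hb' hab (F := fun y => F y / (1 - y ^ 2))
    (hF.div (by fun_prop) fun y hy => (one_sub_sq_pos hy).ne') (fun y => by simp only [he, neg_sq])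
  rw [← h]
  refine intervalIntegral.integral_congr fun k _ => ?_
  have := (one_sub_sq_pos (vel_mem_Ioo (b := b) (k := k) ha)).ne'
  field_simp

lemma cos_mul_cos_mem {a : ℝ} (ha : Real.sin a ≠ 0) (t : ℝ) :
    Real.cos a * Real.cos t ∈ Set.Ioo (-1 : ℝ) 1 := by
  refine abs_lt.1 ?_
  rw [abs_mul]
  exact (mul_le_of_le_one_right (abs_nonneg _) (Real.abs_cos_le_one t)).trans_lt (abs_cos_lt_one ha)

lemma integral_vel_mul_wprod {a b : ℝ} (ha : Real.sin a ≠ 0) (hb : Real.sin b ≠ 0)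
    (ha' : Real.cos a ≠ 0) (hb' : Real.cos b ≠ 0) (hab : |Real.cos a| ≤ |Real.cos b|) {F : ℝ → ℝ}
    (hF : ContinuousOn F (Set.Ioo (-1) 1)) (he : ∀ y, F (-y) = F y) :
    ∫ k in (0)..Real.pi, F (vel a b k) * wprod a b k
      = 2 * |Real.sin a| * (Real.sin b / (Real.cos a * Real.cos b * Real.sin a))
        * ∫ t in (0)..(Real.pi / 2), F (Real.cos a * Real.cos t)
            / (1 - (Real.cos a * Real.cos t) ^ 2)
            * (Real.cos a ^ 2 - (Real.cos a * Real.cos t) ^ 2) := by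
  have h := integral_mul_wprod ha hb ha' hb' hab (F := fun y => F y / (1 - y ^ 2))
    (hF.div (by fun_prop) fun y hy => (one_sub_sq_pos hy).ne') (fun y => by simp only [he, neg_sq])
  have e : ∫ k in (0)..Real.pi, F (vel a b k) * wprod a b k
      = ∫ k in (0)..Real.pi, F (vel a b k) / (1 - vel a b k ^ 2) * (1 - vel a b k ^ 2)
          * wprod a b k := by
    refine intervalIntegral.integral_congr fun k _ => ?_
    have := (one_sub_sq_pos (vel_mem_Ioo (b := b) (k := k) ha)).ne'
    field_simp
  rw [← e] at h
  generalize (∫ k in (0)..Real.pi, F (vel a b k) * wprod a b k) = J at h ⊢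
  field_simp at h ⊢
  linear_combination h

/-- The average of `F(vel)` against `1 + 2 e vel² + 2 f wprod`, the weight of the moving part. -/
lemma integral_vel_weight {a b : ℝ} (ha : Real.sin a ≠ 0) (hb : Real.sin b ≠ 0)
    (ha' : Real.cos a ≠ 0) (hb' : Real.cos b ≠ 0) (hab : |Real.cos a| ≤ |Real.cos b|) {F : ℝ → ℝ}
    (hF : ContinuousOn F (Set.Ioo (-1) 1)) (he : ∀ y, F (-y) = F y) (e f : ℝ) :
    ∫ k in (0)..Real.pi, F (vel a b k) * (1 + (2 * e * vel a b k ^ 2 + 2 * f * wprod a b k))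
      = 2 * |Real.sin a| * ∫ t in (0)..(Real.pi / 2),
          F (Real.cos a * Real.cos t) / (1 - (Real.cos a * Real.cos t) ^ 2)
            * (1 + 2 * e * (Real.cos a * Real.cos t) ^ 2
              + 2 * f * (Real.sin b / (Real.cos a * Real.cos b * Real.sin a))
                * (Real.cos a ^ 2 - (Real.cos a * Real.cos t) ^ 2)) := by
  have hF1 : ContinuousOn (fun y => F y * (1 + 2 * e * y ^ 2)) (Set.Ioo (-1) 1) :=
    hF.mul (by fun_prop)
  have h1 := integral_vel ha hb ha' hb' hab hF1 (fun y => by simp only [he, neg_sq])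
  have h2 := integral_vel_mul_wprod ha hb ha' hb' hab hF he
  have e1 : ∀ k, F (vel a b k) * (1 + (2 * e * vel a b k ^ 2 + 2 * f * wprod a b k))
      = F (vel a b k) * (1 + 2 * e * vel a b k ^ 2) + 2 * f * (F (vel a b k) * wprod a b k) :=
    fun k => by ring
  have hcF : Continuous fun t => F (Real.cos a * Real.cos t) :=
    hF.comp_continuous (by fun_prop) (cos_mul_cos_mem ha)
  have hcD : Continuous fun t =>
      F (Real.cos a * Real.cos t) / (1 - (Real.cos a * Real.cos t) ^ 2) :=
    hcF.div (by fun_prop) fun t => (one_sub_sq_pos (cos_mul_cos_mem ha t)).ne'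
  simp only [e1]
  rw [intervalIntegral.integral_add (intervalIntegrable_vel ha hb' hF1)
    ((intervalIntegrable_vel_mul ha hb' hF (integrableOn_wprod ha' hb')).const_mul _),
    intervalIntegral.integral_const_mul, h1, h2]
  have e2 : ∀ t, F (Real.cos a * Real.cos t) / (1 - (Real.cos a * Real.cos t) ^ 2)
            * (1 + 2 * e * (Real.cos a * Real.cos t) ^ 2
              + 2 * f * (Real.sin b / (Real.cos a * Real.cos b * Real.sin a))
                * (Real.cos a ^ 2 - (Real.cos a * Real.cos t) ^ 2))
      = F (Real.cos a * Real.cos t) * (1 + 2 * e * (Real.cos a * Real.cos t) ^ 2)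
          / (1 - (Real.cos a * Real.cos t) ^ 2)
        + 2 * f * (Real.sin b / (Real.cos a * Real.cos b * Real.sin a))
          * (F (Real.cos a * Real.cos t) / (1 - (Real.cos a * Real.cos t) ^ 2)
            * (Real.cos a ^ 2 - (Real.cos a * Real.cos t) ^ 2)) := fun t => by ring
  simp only [e2]
  rw [intervalIntegral.integral_add, intervalIntegral.integral_const_mul]
  · ring
  · refine Continuous.intervalIntegrable ?_ _ _
    exact (hcF.mul (by fun_prop)).div (by fun_prop)
      fun t => (one_sub_sq_pos (cos_mul_cos_mem ha t)).ne'
  · refine Continuous.intervalIntegrable ?_ _ _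
    exact continuous_const.mul (hcD.mul (by fun_prop))

lemma integral_vel_sq {a b : ℝ} (ha : Real.sin a ≠ 0) (hb : Real.sin b ≠ 0)
    (ha' : Real.cos a ≠ 0) (hb' : Real.cos b ≠ 0) (hab : |Real.cos a| ≤ |Real.cos b|) :
    ∫ k in (0)..Real.pi, vel a b k ^ 2 = Real.pi * (1 - |Real.sin a|) := by
  have h := integral_mul_one_sub_vel_sq ha hb ha' hb' hab (F := fun _ => 1) continuousOn_const
    (fun _ => rfl)
  simp only [one_mul] at h
  rw [intervalIntegral.integral_sub (by simp)
    (intervalIntegrable_vel ha hb' (F := fun y => y ^ 2) (by fun_prop))] at h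
  simp at h
  linear_combination -h

lemma integral_wprod {a b : ℝ} (ha : Real.sin a ≠ 0) (hb : Real.sin b ≠ 0)
    (ha' : Real.cos a ≠ 0) (hb' : Real.cos b ≠ 0) (hab : |Real.cos a| ≤ |Real.cos b|) :
    ∫ k in (0)..Real.pi, wprod a b k
      = Real.pi * ((|Real.sin a| * (Real.sin b / Real.sin a) - Real.sin a * Real.sin b)
        / (Real.cos a * Real.cos b)) := by
  have h := integral_mul_wprod_add ha hb ha' hb' hab (F := fun _ => 1) continuousOn_const
    (fun _ => rfl)
  have hw := intervalIntegrable_wprod ha' hb'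
  simp only [one_mul] at h
  rw [intervalIntegral.integral_add (hw.const_mul _) (by simp),
    intervalIntegral.integral_const_mul] at h
  simp at h
  field_simp at h ⊢
  linear_combination h

end

/-! ### Positivity -/

section

open Complex ComplexConjugate ComplexOrder

/-- The matrix `1 + N` is positive semidefinite if `N` has norm at most `1`. -/
lemma posSemidef_of_sq_le {v r y : ℝ} (h : v ^ 2 + r ^ 2 + y ^ 2 ≤ 1) :
    (!![((1 + v : ℝ) : ℂ), r + I * y; r - I * y, ((1 - v : ℝ) : ℂ)]).PosSemidef := by
  refine Matrix.PosSemidef.of_dotProduct_mulVec_nonneg ?_ fun x => ?_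
  · ext i j
    fin_cases i <;> fin_cases j <;> simp [Matrix.conjTranspose_apply, sub_eq_add_neg]
  · rw [Complex.nonneg_iff]
    simp only [dotProduct, Matrix.mulVec, Fin.sum_univ_two, Pi.star_apply, Complex.star_def]
    simp
    constructor
    · generalize (x 0).re = a
      generalize (x 0).im = b
      generalize (x 1).re = c
      generalize (x 1).im = d
      have hv : v ^ 2 ≤ 1 := by nlinarith [sq_nonneg r, sq_nonneg y]
      have hv1 : 0 ≤ 1 + v := by nlinarith
      rcases hv1.eq_or_lt with h0 | h0
      · have hv' : v = -1 := by linarith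
        subst hv'
        have hr : r = 0 := by nlinarith [sq_nonneg r, sq_nonneg y]
        have hy : y = 0 := by nlinarith [sq_nonneg r, sq_nonneg y]
        subst hr hy
        nlinarith [sq_nonneg c, sq_nonneg d]
      · refine nonneg_of_mul_nonneg_right ?_ h0
        have h1 : 0 ≤ (1 - v ^ 2 - r ^ 2 - y ^ 2) * (c ^ 2 + d ^ 2) :=
          mul_nonneg (by linarith) (by positivity)
        have h2 := sq_nonneg ((1 + v) * a + (r * c - y * d))
        have h3 := sq_nonneg ((1 + v) * b + (r * d + y * c))
        linarith
    · ring

lemma tensorForm_nonneg (q : Fin 4 → ℂ) {v r y v' r' y' : ℝ} (h : v ^ 2 + r ^ 2 + y ^ 2 ≤ 1)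
    (h' : v' ^ 2 + r' ^ 2 + y' ^ 2 ≤ 1) :
    0 ≤ (tensorForm (amp q) !![((1 + v : ℝ) : ℂ), r + I * y; r - I * y, ((1 - v : ℝ) : ℂ)]
      !![((1 + v' : ℝ) : ℂ), r' + I * y'; r' - I * y', ((1 - v' : ℝ) : ℂ)]).re :=
  (Complex.nonneg_iff.1 (((posSemidef_of_sq_le h).kronecker
    (posSemidef_of_sq_le h')).dotProduct_mulVec_nonneg (amp q))).1

/-- Positivity of `⟨(1 + N) ⊗ (1 + N')⟩`, averaged over a simultaneous sign change of `y`
and `y'`. -/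
lemma one_add_lin_add_quad_nonneg (q : Fin 4 → ℂ) (hq : ∑ i, ‖q i‖ ^ 2 = 1) {v r y r' y' : ℝ}
    (h : v ^ 2 + r ^ 2 + y ^ 2 ≤ 1) (h' : v ^ 2 + r' ^ 2 + y' ^ 2 ≤ 1) :
    0 ≤ 1 + linForm q v r r' + quadForm q v r r' (y * y') := by
  have h1 := tensorForm_nonneg q h h'
  have h2 := tensorForm_nonneg q (y := -y) (y' := -y') (by simpa using h) (by simpa using h')
  have h3 := add_nonneg h1 h2
  rw [Fin.sum_univ_four] at hq
  simp only [tensorForm_amp, linForm, quadForm, cr, ← Complex.normSq_eq_norm_sq,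
    Complex.normSq_apply] at hq h3 ⊢
  simp only [pow_two (M := ℝ)] at h3 ⊢
  simp at h3 ⊢
  linear_combination h3 / 2 + hq

/-- Positivity of `⟨(1 - N) ⊗ (1 + N') + (1 + N) ⊗ (1 - N')⟩`, averaged over a simultaneous sign
change of `y` and `y'`. -/
lemma quad_le_one (q : Fin 4 → ℂ) (hq : ∑ i, ‖q i‖ ^ 2 = 1) {v r y r' y' : ℝ}
    (h : v ^ 2 + r ^ 2 + y ^ 2 ≤ 1) (h' : v ^ 2 + r' ^ 2 + y' ^ 2 ≤ 1) :
    quadForm q v r r' (y * y') ≤ 1 := by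
  have h1 := tensorForm_nonneg q (v := -v) (r := -r) (y := -y) (by simpa using h) h'
  have h2 := tensorForm_nonneg q (v' := -v) (r' := -r') (y' := -y') h (by simpa using h')
  have h3 := tensorForm_nonneg q (v := -v) (r := -r) (y' := -y') (by simpa using h)
    (by simpa using h')
  have h4 := tensorForm_nonneg q (v' := -v) (r' := -r') (y := -y) (by simpa using h)
    (by simpa using h')
  have h5 := add_nonneg (add_nonneg h1 h2) (add_nonneg h3 h4)
  rw [Fin.sum_univ_four] at hq
  simp only [tensorForm_amp, quadForm, cr, ← Complex.normSq_eq_norm_sq,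
    Complex.normSq_apply] at hq h5 ⊢
  simp only [pow_two (M := ℝ)] at h5 ⊢
  simp at h5 ⊢
  linear_combination h5 / 4 + hq

lemma vel_sq_add {a b k : ℝ} (hb : Real.cos b ≠ 0) (hk : Real.sin k ≠ 0) :
    vel a b k ^ 2 + (vel a b k * (Real.sin b / Real.cos b)) ^ 2 + (cross b a k / gsin a b k) ^ 2
      = 1 := by
  have hg := gsin_pos (a := a) hb hk
  have h1 := gsin_sq' b a k
  rw [gsin_comm] at h1
  have hb2 := Real.sin_sq_add_cos_sq b
  rw [vel]
  field_simp
  rw [h1]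
  linear_combination (Real.cos a ^ 2 * Real.sin k ^ 2) * hb2

lemma corr_le_one {θ : Fin 2 → ℝ} (hc : ∀ i, c θ i ≠ 0) (q : Fin 4 → ℂ)
    (hq : ∑ i, ‖q i‖ ^ 2 = 1) {k : ℝ} (hk : Real.sin k ≠ 0) : corr θ q k ≤ 1 := by
  have h1 := vel_sq_add (a := θ 0) (hc 1) hk
  have h2 := vel_sq_add (a := θ 1) (hc 0) hk
  rw [vel_comm] at h2
  have h3 := quad_le_one q hq h1.le h2.le
  have h4 := quadForm_vel hc q (vel (θ 0) (θ 1) k)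
  simp only [s, c] at h4
  have hw : cross (θ 1) (θ 0) k / gsin (θ 0) (θ 1) k * (cross (θ 0) (θ 1) k / gsin (θ 1) (θ 0) k)
      = wprod (θ 0) (θ 1) k := by rw [wprod, gsin_comm (θ 0) (θ 1)]; ring
  rwa [h4, hw] at h3

/-- The density involves the average of `w = y y'` over the momenta of velocity `v`. This average
is again a product of imaginary parts for which `N` and `N'` have norm at most `1`, which is where
`|c_m| ≤ |c_M|` enters. -/
lemma exists_imaginary_parts {cm cM sm sM v : ℝ} (hm : sm ^ 2 + cm ^ 2 = 1)
    (hM : sM ^ 2 + cM ^ 2 = 1)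
    (hcm : cm ≠ 0) (hcM : cM ≠ 0) (hsm : sm ≠ 0) (hle : cm ^ 2 ≤ cM ^ 2) (hv : v ^ 2 ≤ cm ^ 2) :
    ∃ y y' : ℝ, y * y' = sM / (cm * cM * sm) * (cm ^ 2 - v ^ 2) ∧
      v ^ 2 + (v * (sm / cm)) ^ 2 + y ^ 2 ≤ 1 ∧ v ^ 2 + (v * (sM / cM)) ^ 2 + y' ^ 2 ≤ 1 := by
  have h0 : 0 ≤ 1 - v ^ 2 / cm ^ 2 := by
    rw [sub_nonneg, div_le_one (by positivity)]; exact hv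
  have hsq := Real.sq_sqrt h0
  -- `y` saturates the bound for `N`, and the prescribed product then determines `y'`.
  refine ⟨√(1 - v ^ 2 / cm ^ 2), sM * cm / (cM * sm) * √(1 - v ^ 2 / cm ^ 2), ?_, ?_, ?_⟩
  · rw [show √(1 - v ^ 2 / cm ^ 2) * (sM * cm / (cM * sm) * √(1 - v ^ 2 / cm ^ 2))
      = sM * cm / (cM * sm) * √(1 - v ^ 2 / cm ^ 2) ^ 2 by ring, hsq]
    field_simp
  · rw [hsq]
    refine le_of_eq ?_
    field_simp
    linear_combination v ^ 2 * hm
  · rw [mul_pow _ (√(1 - v ^ 2 / cm ^ 2)), hsq]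
    have e : 1 - (v ^ 2 + (v * (sM / cM)) ^ 2 + (sM * cm / (cM * sm)) ^ 2 * (1 - v ^ 2 / cm ^ 2))
        = (cM ^ 2 - cm ^ 2) * (1 - v ^ 2) / (cM ^ 2 * sm ^ 2) := by
      field_simp
      rw [eq_sub_of_add_eq hm, eq_sub_of_add_eq hM]
      ring
    have : 0 ≤ (cM ^ 2 - cm ^ 2) * (1 - v ^ 2) / (cM ^ 2 * sm ^ 2) := by
      refine div_nonneg (mul_nonneg (by linarith) ?_) (by positivity)
      nlinarith [sq_nonneg sm]
    linarith

lemma numerator_nonneg {θ : Fin 2 → ℝ} (hc : ∀ i, c θ i ≠ 0) (hs : ∀ i, s θ i ≠ 0) (q : Fin 4 → ℂ)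
    (hq : ∑ i, ‖q i‖ ^ 2 = 1) {m M : Fin 2} (hmM : m ≠ M) (hle : |c θ m| ≤ |c θ M|) {y : ℝ}
    (hy : |y| ≤ 2 * |c θ m|) : 0 ≤ d₀ θ q m M + d₁ θ q * y + d₂ θ q m M * y ^ 2 := by
  have hv : (-(y / 2)) ^ 2 ≤ c θ m ^ 2 := by
    rw [sq_le_sq, abs_neg, abs_div, abs_two]; linarith
  have hle' : c θ m ^ 2 ≤ c θ M ^ 2 := sq_le_sq.2 hle
  obtain ⟨z, z', hzz, hz, hz'⟩ := exists_imaginary_parts (Real.sin_sq_add_cos_sq (θ m))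
    (Real.sin_sq_add_cos_sq (θ M)) (hc m) (hc M) (hs m) hle' hv
  have h := hc 0; have h' := hc 1; have hsm := hs m
  have hC : c θ m * c θ M = c θ 0 * c θ 1 := by
    fin_cases m <;> fin_cases M <;> simp_all [mul_comm]
  change z * z' = s θ M / (c θ m * c θ M * s θ m) * (c θ m ^ 2 - (-(y / 2)) ^ 2) at hzz
  rw [hC] at hzz
  have key : 0 ≤ 1 + linForm q (-(y / 2)) (-(y / 2) * (s θ 1 / c θ 1)) (-(y / 2) * (s θ 0 / c θ 0))
      + quadForm q (-(y / 2)) (-(y / 2) * (s θ 1 / c θ 1)) (-(y / 2) * (s θ 0 / c θ 0))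
          (z * z') := by
    fin_cases m <;> fin_cases M
    · exact absurd rfl hmM
    · rw [mul_comm z z']; exact one_add_lin_add_quad_nonneg q hq hz' hz
    · exact one_add_lin_add_quad_nonneg q hq hz hz'
    · exact absurd rfl hmM
  rw [linForm_vel, quadForm_vel hc, hzz] at key
  have e : d₀ θ q m M + d₁ θ q * y + d₂ θ q m M * y ^ 2
      = 2 * (1 + -(-(y / 2) * d₁ θ q) + (2 * velCoef θ q * (-(y / 2)) ^ 2
        + 2 * (cr q 1 2 - cr q 0 3)
          * (s θ M / (c θ 0 * c θ 1 * s θ m) * (c θ m ^ 2 - (-(y / 2)) ^ 2)))) := by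
    rw [d₂_eq, d₀]; ring
  rw [e]
  linarith

lemma density_nonneg {θ : Fin 2 → ℝ} (hc : ∀ i, c θ i ≠ 0) (hs : ∀ i, s θ i ≠ 0) (q : Fin 4 → ℂ)
    (hq : ∑ i, ‖q i‖ ^ 2 = 1) {m M : Fin 2} (hmM : m ≠ M) (hle : |c θ m| ≤ |c θ M|) (y : ℝ) :
    0 ≤ density θ q m M y := by
  refine Set.indicator_nonneg (fun y hy => ?_) y
  rw [neg_mul] at hy
  have hy' := abs_lt.2 hy
  refine div_nonneg (mul_nonneg (abs_nonneg _) (numerator_nonneg hc hs q hq hmM hle hy'.le)) ?_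
  have h1 : |c θ m| < 1 := abs_cos_lt_one (hs m)
  have h4 : 0 ≤ 4 - y ^ 2 := by
    have : |y| ^ 2 ≤ 2 ^ 2 := pow_le_pow_left₀ (abs_nonneg _) (by linarith) 2
    rw [sq_abs] at this
    linarith
  have := Real.pi_pos
  positivity

end

/-! ### The limit law -/

section

open Complex ComplexConjugate

lemma sin_image_Ioo {R : ℝ} (hR : 0 < R) :
    (fun t => R * Real.sin t) '' Set.Ioo (-(Real.pi / 2)) (Real.pi / 2) = Set.Ioo (-R) R := by
  ext y
  constructor
  · rintro ⟨t, ht, rfl⟩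
    have h1 := Real.strictMonoOn_sin ⟨le_rfl, by linarith [Real.pi_pos]⟩
      ⟨ht.1.le, ht.2.le⟩ ht.1
    have h2 := Real.strictMonoOn_sin ⟨ht.1.le, ht.2.le⟩ ⟨by linarith [Real.pi_pos], le_rfl⟩ ht.2
    rw [Real.sin_neg, Real.sin_pi_div_two] at h1
    rw [Real.sin_pi_div_two] at h2
    constructor <;> simp only <;> nlinarith
  · intro hy
    have h1 : -1 < y / R := by rw [lt_div_iff₀ hR]; linarith [hy.1]
    have h2 : y / R < 1 := by rw [div_lt_one hR]; exact hy.2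
    refine ⟨Real.arcsin (y / R), ⟨Real.neg_pi_div_two_lt_arcsin.2 h1,
      Real.arcsin_lt_pi_div_two.2 h2⟩, ?_⟩
    simp only
    rw [Real.sin_arcsin h1.le h2.le]
    field_simp

lemma integral_symm_cos {h : ℝ → ℝ} (hh : Continuous fun t => h (Real.sin t)) :
    ∫ t in (-(Real.pi / 2))..(Real.pi / 2), h (Real.sin t)
      = ∫ t in (0)..(Real.pi / 2), (h (Real.cos t) + h (-Real.cos t)) := by
  have hc : Continuous fun t => h (Real.cos t) := by
    have := hh.comp (by fun_prop : Continuous fun t : ℝ => Real.pi / 2 - t)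
    simpa only [Function.comp_def, Real.sin_pi_div_two_sub] using this
  have hc' : Continuous fun t => h (-Real.cos t) := by
    have := hc.comp (by fun_prop : Continuous fun t : ℝ => Real.pi - t)
    simpa only [Function.comp_def, Real.cos_pi_sub] using this
  have e1 : ∫ t in (0)..(Real.pi / 2), h (Real.cos t)
      = ∫ t in (0)..(Real.pi / 2), h (Real.sin t) := by
    have := intervalIntegral.integral_comp_sub_left (a := 0) (b := Real.pi / 2)
      (fun t => h (Real.sin t)) (Real.pi / 2)
    simpa only [Real.sin_pi_div_two_sub, sub_self, sub_zero] using this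
  have e2 : ∫ t in (0)..(Real.pi / 2), h (-Real.cos t)
      = ∫ t in (-(Real.pi / 2))..0, h (Real.sin t) := by
    have := intervalIntegral.integral_comp_sub_right (a := 0) (b := Real.pi / 2)
      (fun t => h (Real.sin t)) (Real.pi / 2)
    simpa only [Real.sin_sub_pi_div_two, sub_self, zero_sub] using this
  rw [intervalIntegral.integral_add (hc.intervalIntegrable _ _) (hc'.intervalIntegrable _ _), e1,
    e2, add_comm, intervalIntegral.integral_add_adjacent_intervals (hh.intervalIntegrable _ _)
      (hh.intervalIntegrable _ _)]

/-- Integration against an arcsine density by the substitution `y = R sin t`. -/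
lemma integral_arcsine {h : ℝ → ℝ} {R : ℝ} (hR : 0 < R) (hh : ContinuousOn h (Set.Icc (-R) R)) :
    IntegrableOn (fun y => h y / √(R ^ 2 - y ^ 2)) (Set.Ioo (-R) R) ∧
    ∫ y in Set.Ioo (-R) R, h y / √(R ^ 2 - y ^ 2)
      = ∫ t in (0)..(Real.pi / 2), (h (R * Real.cos t) + h (-(R * Real.cos t))) := by
  set S := Set.Ioo (-(Real.pi / 2)) (Real.pi / 2) with hS
  have hder : ∀ t ∈ S, HasDerivWithinAt (fun t => R * Real.sin t) (R * Real.cos t) S t :=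
    fun t _ => ((Real.hasDerivAt_sin t).const_mul R).hasDerivWithinAt
  have hinj : Set.InjOn (fun t => R * Real.sin t) S := fun x hx y hy hxy =>
    Real.injOn_sin ⟨hx.1.le, hx.2.le⟩ ⟨hy.1.le, hy.2.le⟩ (mul_left_cancel₀ hR.ne' hxy)
  have hcont : Continuous fun t => h (R * Real.sin t) := by
    refine hh.comp_continuous (by fun_prop) fun t => abs_le.1 ?_
    rw [abs_mul, abs_of_pos hR]
    exact mul_le_of_le_one_right hR.le (Real.abs_sin_le_one t)
  have hfun : ∀ t ∈ S, h (R * Real.sin t) = |R * Real.cos t| •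
      (h (R * Real.sin t) / √(R ^ 2 - (R * Real.sin t) ^ 2)) := by
    intro t ht
    have hct := Real.cos_pos_of_mem_Ioo ht
    have hc : 0 < R * Real.cos t := mul_pos hR hct
    have : R ^ 2 - (R * Real.sin t) ^ 2 = (R * Real.cos t) ^ 2 := by
      rw [mul_pow, mul_pow, Real.cos_sq']; ring
    rw [this, Real.sqrt_sq hc.le, abs_of_pos hc, smul_eq_mul, mul_div_cancel₀ _ hc.ne']
  have hle : -(Real.pi / 2) ≤ Real.pi / 2 := by linarith [Real.pi_pos]
  constructor
  · rw [← sin_image_Ioo hR, integrableOn_image_iff_integrableOn_abs_deriv_smul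
      measurableSet_Ioo hder hinj]
    exact IntegrableOn.congr_fun (hcont.integrableOn_Icc.mono_set Set.Ioo_subset_Icc_self) hfun
      measurableSet_Ioo
  · have hsym := integral_symm_cos (h := fun u => h (R * u)) hcont
    simp only [mul_neg] at hsym
    rw [← hsym, ← sin_image_Ioo hR,
      integral_image_eq_integral_abs_deriv_smul measurableSet_Ioo hder hinj,
      ← setIntegral_congr_fun measurableSet_Ioo hfun, intervalIntegral.integral_of_le hle,
      integral_Ioc_eq_integral_Ioo]

/-- The density without its inverse square root factor. -/
def smoothPart (θ : Fin 2 → ℝ) (q : Fin 4 → ℂ) (m M : Fin 2) (y : ℝ) : ℝ :=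
  |s θ m| * (d₀ θ q m M + d₁ θ q * y + d₂ θ q m M * y ^ 2) / (Real.pi * (4 - y ^ 2))

lemma mul_density_eq (θ : Fin 2 → ℝ) (q : Fin 4 → ℂ) (m M : Fin 2) (Q : ℝ → ℝ) :
    (fun y => Q y * density θ q m M y) = (Set.Ioo (-(2 * |c θ m|)) (2 * |c θ m|)).indicator
      fun y => Q y * smoothPart θ q m M y / √((2 * |c θ m|) ^ 2 - y ^ 2) := by
  funext y
  rw [density, neg_mul]
  by_cases hy : y ∈ Set.Ioo (-(2 * |c θ m|)) (2 * |c θ m|)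
  · rw [Set.indicator_of_mem hy, Set.indicator_of_mem hy, smoothPart, mul_pow, sq_abs,
      ← div_div]
    norm_num
    ring
  · rw [Set.indicator_of_notMem hy, Set.indicator_of_notMem hy, mul_zero]

/-- Integrals against the density, as integrals over a quarter turn. -/
lemma mul_density {θ : Fin 2 → ℝ} (hc : ∀ i, c θ i ≠ 0) (hs : ∀ i, s θ i ≠ 0) (q : Fin 4 → ℂ)
    (m M : Fin 2) {Q : ℝ → ℝ} (hQ : Continuous Q) :
    Integrable (fun y => Q y * density θ q m M y) ∧
    ∫ y, Q y * density θ q m M y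
      = ∫ t in (0)..(Real.pi / 2), (Q (2 * (c θ m * Real.cos t)) * smoothPart θ q m M
          (2 * (c θ m * Real.cos t)) + Q (-(2 * (c θ m * Real.cos t))) * smoothPart θ q m M
          (-(2 * (c θ m * Real.cos t)))) := by
  have hR : 0 < 2 * |c θ m| := by have := hc m; positivity
  have h1 : |c θ m| < 1 := abs_cos_lt_one (hs m)
  have hcont : ContinuousOn (fun y => Q y * smoothPart θ q m M y)
      (Set.Icc (-(2 * |c θ m|)) (2 * |c θ m|)) := by
    refine hQ.continuousOn.mul (ContinuousOn.div (by fun_prop) (by fun_prop) fun y hy => ?_)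
    have hy' := abs_le.2 hy
    have : |y| ^ 2 < 2 ^ 2 := pow_lt_pow_left₀ (by linarith) (abs_nonneg _) two_ne_zero
    rw [sq_abs] at this
    have h4 : 4 - y ^ 2 ≠ 0 := by linarith
    exact mul_ne_zero Real.pi_ne_zero h4
  obtain ⟨hi, he⟩ := integral_arcsine hR hcont
  rw [mul_density_eq]
  constructor
  · exact (integrable_indicator_iff measurableSet_Ioo).2 hi
  · rw [integral_indicator measurableSet_Ioo, he]
    refine intervalIntegral.integral_congr fun t _ => ?_
    rcases abs_choice (c θ m) with h | h <;> simp only [h]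
    · rw [mul_assoc]
    · rw [mul_assoc, neg_mul, mul_neg, neg_neg, add_comm]

lemma vel_pair {θ : Fin 2 → ℝ} {m M : Fin 2} (hmM : m ≠ M) (k : ℝ) :
    vel (θ 0) (θ 1) k = vel (θ m) (θ M) k := by
  fin_cases m <;> fin_cases M
  · exact absurd rfl hmM
  · rfl
  · exact vel_comm _ _ _
  · exact absurd rfl hmM

lemma wprod_pair {θ : Fin 2 → ℝ} {m M : Fin 2} (hmM : m ≠ M) (k : ℝ) :
    wprod (θ 0) (θ 1) k = wprod (θ m) (θ M) k := by
  fin_cases m <;> fin_cases M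
  · exact absurd rfl hmM
  · rfl
  · exact wprod_comm _ _ _
  · exact absurd rfl hmM

lemma c_pair {θ : Fin 2 → ℝ} {m M : Fin 2} (hmM : m ≠ M) : c θ 0 * c θ 1 = c θ m * c θ M := by
  fin_cases m <;> fin_cases M
  · exact absurd rfl hmM
  · rfl
  · exact mul_comm _ _
  · exact absurd rfl hmM

lemma s_pair {θ : Fin 2 → ℝ} {m M : Fin 2} (hmM : m ≠ M) : s θ 0 * s θ 1 = s θ m * s θ M := by
  fin_cases m <;> fin_cases M
  · exact absurd rfl hmM
  · rfl
  · exact mul_comm _ _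
  · exact absurd rfl hmM

lemma abs_s_pair {θ : Fin 2 → ℝ} {m M : Fin 2} (hmM : m ≠ M) :
    |s θ 0 - s θ 1| = |s θ m - s θ M| ∧ |s θ 0 + s θ 1| = |s θ m + s θ M| := by
  fin_cases m <;> fin_cases M
  · exact absurd rfl hmM
  · exact ⟨rfl, rfl⟩
  · exact ⟨abs_sub_comm _ _, congrArg abs (add_comm _ _)⟩
  · exact absurd rfl hmM

/-- Rewrites `|s₁ ± s₂|` in `atomMass_eq` through the dominant sine `s_m`. -/
lemma abs_sub_add_abs_add {x y : ℝ} (hx : x ≠ 0) (h : |y| ≤ |x|) :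
    |x - y| + |x + y| = 2 * |x| ∧ |x + y| - |x - y| = 2 * (|x| * (y / x)) := by
  rcases lt_or_gt_of_ne hx with h0 | h0
  · rw [abs_of_neg h0] at h ⊢
    have := abs_le.1 h
    rw [abs_of_nonpos (by linarith : x - y ≤ 0), abs_of_nonpos (by linarith : x + y ≤ 0)]
    exact ⟨by ring, by field_simp; ring⟩
  · rw [abs_of_pos h0] at h ⊢
    have := abs_le.1 h
    rw [abs_of_nonneg (by linarith : 0 ≤ x - y), abs_of_nonneg (by linarith : 0 ≤ x + y)]
    exact ⟨by ring, by field_simp; ring⟩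

lemma abs_s_le {θ : Fin 2 → ℝ} {m M : Fin 2} (hle : |c θ m| ≤ |c θ M|) : |s θ M| ≤ |s θ m| := by
  rw [← sq_le_sq] at hle ⊢
  have h1 := c_sq θ m
  have h2 := c_sq θ M
  linarith

lemma intervalIntegrable_corr {θ : Fin 2 → ℝ} (hc : ∀ i, c θ i ≠ 0) (hs : ∀ i, s θ i ≠ 0)
    (q : Fin 4 → ℂ) : IntervalIntegrable (corr θ q) volume 0 Real.pi := by
  have h1 := intervalIntegrable_vel (b := θ 1) (hs 0) (hc 1) (F := fun y => y ^ 2) (by fun_prop)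
  have h2 := intervalIntegrable_wprod (hc 0) (hc 1)
  exact (h1.const_mul _).add (h2.const_mul _)

/-- The part of the folded limit that does not depend on `ξ` integrates to the mass of the atom. -/
lemma integral_one_sub_corr {θ : Fin 2 → ℝ} (hc : ∀ i, c θ i ≠ 0) (hs : ∀ i, s θ i ≠ 0)
    (q : Fin 4 → ℂ) (hq : ∑ i, ‖q i‖ ^ 2 = 1) {m M : Fin 2} (hmM : m ≠ M)
    (hle : |c θ m| ≤ |c θ M|) :
    ∫ k in (0)..Real.pi, (1 - corr θ q k) = 2 * Real.pi * atomMass θ q := by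
  have h1 := intervalIntegrable_vel (b := θ M) (hs m) (hc M) (F := fun y => y ^ 2) (by fun_prop)
  have h2 := intervalIntegrable_wprod (hc m) (hc M)
  rw [intervalIntegral.integral_sub (by simp) (intervalIntegrable_corr hc hs q)]
  simp only [corr, vel_pair hmM, wprod_pair hmM]
  rw [intervalIntegral.integral_add (h1.const_mul _) (h2.const_mul _),
    intervalIntegral.integral_const_mul, intervalIntegral.integral_const_mul,
    integral_vel_sq (hs m) (hs M) (hc m) (hc M) hle, integral_wprod (hs m) (hs M) (hc m) (hc M) hle,
    atomMass_eq hc q hq, c_pair hmM, s_pair hmM, (abs_s_pair hmM).1, (abs_s_pair hmM).2,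
    (abs_sub_add_abs_add (hs m) (abs_s_le hle)).1, (abs_sub_add_abs_add (hs m) (abs_s_le hle)).2]
  change _ - (_ * (_ * (1 - |s θ m|)) + _ * (_ * ((|s θ m| * (s θ M / s θ m) - s θ m * s θ M)
    / (c θ m * c θ M)))) = _
  simp
  ring

lemma atomMass_nonneg {θ : Fin 2 → ℝ} (hc : ∀ i, c θ i ≠ 0) (hs : ∀ i, s θ i ≠ 0)
    (q : Fin 4 → ℂ) (hq : ∑ i, ‖q i‖ ^ 2 = 1) {m M : Fin 2} (hmM : m ≠ M)
    (hle : |c θ m| ≤ |c θ M|) : 0 ≤ atomMass θ q := by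
  have h := integral_one_sub_corr hc hs q hq hmM hle
  have h1 : 0 ≤ ∫ k in (0)..Real.pi, (1 - corr θ q k) := by
    rw [intervalIntegral.integral_of_le Real.pi_pos.le, integral_Ioc_eq_integral_Ioo]
    refine setIntegral_nonneg measurableSet_Ioo fun k hk => ?_
    have := corr_le_one hc q hq (sin_pos_of_mem hk).ne'
    linarith
  rw [h] at h1
  exact nonneg_of_mul_nonneg_right h1 (by positivity)

lemma integral_cos_density {θ : Fin 2 → ℝ} (hc : ∀ i, c θ i ≠ 0) (hs : ∀ i, s θ i ≠ 0)
    (q : Fin 4 → ℂ) {m M : Fin 2} (hmM : m ≠ M) (hle : |c θ m| ≤ |c θ M|) (ξ : ℝ) :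
    ∫ k in (0)..Real.pi, Real.cos (2 * ξ * vel (θ 0) (θ 1) k) * (1 + corr θ q k)
      = 2 * Real.pi * ∫ y, Real.cos (ξ * y) * density θ q m M y := by
  rw [(mul_density hc hs q m M (Q := fun y => Real.cos (ξ * y)) (by fun_prop)).2]
  simp only [corr, vel_pair hmM, wprod_pair hmM]
  have h := integral_vel_weight (hs m) (hs M) (hc m) (hc M) hle
    (F := fun y => Real.cos (2 * ξ * y)) (by fun_prop)
    (fun y => by rw [mul_neg, Real.cos_neg]) (velCoef θ q) (cr q 1 2 - cr q 0 3)
  rw [h, ← intervalIntegral.integral_const_mul, ← intervalIntegral.integral_const_mul]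
  refine intervalIntegral.integral_congr fun t _ => ?_
  have hx := (one_sub_sq_pos (cos_mul_cos_mem (hs m) t)).ne'
  have hsm := hs m
  have hcm := hc m
  have hcM := hc M
  change _ * (_ / (1 - (c θ m * Real.cos t) ^ 2) * (1 + _ * (c θ m * Real.cos t) ^ 2
    + _ * (s θ M / (c θ m * c θ M * s θ m)) * (c θ m ^ 2 - (c θ m * Real.cos t) ^ 2))) = _
  change 1 - (c θ m * Real.cos t) ^ 2 ≠ 0 at hx
  change 2 * |s θ m| * (Real.cos (2 * ξ * (c θ m * Real.cos t)) / _ * _) = _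
  generalize c θ m * Real.cos t = x at *
  have e1 : Real.cos (ξ * -(2 * x)) = Real.cos (2 * ξ * x) := by
    rw [mul_neg, Real.cos_neg]; ring_nf
  have e2 : Real.cos (ξ * (2 * x)) = Real.cos (2 * ξ * x) := by ring_nf
  have h4 : 4 - (2 * x) ^ 2 = 4 * (1 - x ^ 2) := by ring
  simp only [e1, e2, smoothPart, d₂_eq, d₀, c_pair hmM, neg_sq, h4]
  have := Real.pi_ne_zero
  field_simp
  ring

lemma integral_sin_density {θ : Fin 2 → ℝ} (hc : ∀ i, c θ i ≠ 0) (hs : ∀ i, s θ i ≠ 0)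
    (q : Fin 4 → ℂ) {m M : Fin 2} (hmM : m ≠ M) (hle : |c θ m| ≤ |c θ M|) (ξ : ℝ) :
    ∫ k in (0)..Real.pi, d₁ θ q * (Real.sin (2 * ξ * vel (θ 0) (θ 1) k) * vel (θ 0) (θ 1) k)
      = 2 * Real.pi * ∫ y, Real.sin (ξ * y) * density θ q m M y := by
  rw [(mul_density hc hs q m M (Q := fun y => Real.sin (ξ * y)) (by fun_prop)).2]
  simp only [vel_pair hmM]
  have h := integral_vel (hs m) (hs M) (hc m) (hc M) hle
    (F := fun y => d₁ θ q * (Real.sin (2 * ξ * y) * y)) (by fun_prop)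
    (fun y => by rw [mul_neg (2 * ξ), Real.sin_neg]; ring)
  rw [h, ← intervalIntegral.integral_const_mul, ← intervalIntegral.integral_const_mul]
  refine intervalIntegral.integral_congr fun t _ => ?_
  have hx := (one_sub_sq_pos (cos_mul_cos_mem (hs m) t)).ne'
  change 1 - (c θ m * Real.cos t) ^ 2 ≠ 0 at hx
  change 2 * |s θ m| * (d₁ θ q * (Real.sin (2 * ξ * (c θ m * Real.cos t)) * (c θ m * Real.cos t))
    / (1 - (c θ m * Real.cos t) ^ 2)) = _
  generalize c θ m * Real.cos t = x at *
  have e1 : Real.sin (ξ * -(2 * x)) = -Real.sin (2 * ξ * x) := by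
    rw [mul_neg, Real.sin_neg]; ring_nf
  have e2 : Real.sin (ξ * (2 * x)) = Real.sin (2 * ξ * x) := by ring_nf
  have h4 : 4 - (2 * x) ^ 2 = 4 * (1 - x ^ 2) := by ring
  simp only [e1, e2, smoothPart, neg_sq, h4]
  have := Real.pi_ne_zero
  field_simp
  ring

lemma intervalIntegrable_ofReal {f : ℝ → ℝ} {a b : ℝ} (h : IntervalIntegrable f volume a b) :
    IntervalIntegrable (fun x => (f x : ℂ)) volume a b :=
  ⟨h.1.ofReal, h.2.ofReal⟩

/-- The limit of the characteristic functions is the characteristic function of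
`Δ δ₀ + f(y) dy`. -/
lemma integral_fold_eq {θ : Fin 2 → ℝ} (hc : ∀ i, c θ i ≠ 0) (hs : ∀ i, s θ i ≠ 0)
    (q : Fin 4 → ℂ) (hq : ∑ i, ‖q i‖ ^ 2 = 1) {m M : Fin 2} (hmM : m ≠ M)
    (hle : |c θ m| ≤ |c θ M|) (ξ : ℝ) :
    (2 * Real.pi : ℂ)⁻¹ * ∫ k in (0)..Real.pi,
        (tensorForm (amp q) (phaseMatrix ξ (θ 0) (θ 1) k) (phaseMatrix ξ (θ 1) (θ 0) k)
          + tensorForm (amp q) (phaseMatrix ξ (θ 0) (θ 1) (-k)) (phaseMatrix ξ (θ 1) (θ 0) (-k)))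
      = (atomMass θ q : ℂ) + ∫ y : ℝ, exp (ξ * y * I) * (density θ q m M y : ℂ) := by
  simp only [tensorForm_phaseMatrix_fold hc q hq]
  have hF : ∀ {F : ℝ → ℝ}, Continuous F →
      IntervalIntegrable (fun k => F (vel (θ 0) (θ 1) k)) volume 0 Real.pi :=
    fun h => intervalIntegrable_vel (hs 0) (hc 1) h.continuousOn
  have hcorr := intervalIntegrable_corr hc hs q
  have i1 : IntervalIntegrable (fun k => 1 - corr θ q k) volume 0 Real.pi :=
    (by simp : IntervalIntegrable (fun _ => (1 : ℝ)) volume 0 Real.pi).sub hcorr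
  have i2 : IntervalIntegrable (fun k => Real.cos (2 * ξ * vel (θ 0) (θ 1) k) * (1 + corr θ q k))
      volume 0 Real.pi := by
    refine intervalIntegrable_vel_mul (F := fun y => Real.cos (2 * ξ * y)) (hs 0) (hc 1)
      (by fun_prop) ?_
    rw [← intervalIntegrable_iff_integrableOn_Ioo_of_le Real.pi_pos.le]
    exact (by simp : IntervalIntegrable (fun _ => (1 : ℝ)) volume 0 Real.pi).add hcorr
  have i3 : IntervalIntegrable (fun k => d₁ θ q * (Real.sin (2 * ξ * vel (θ 0) (θ 1) k)
      * vel (θ 0) (θ 1) k)) volume 0 Real.pi :=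
    hF (F := fun y => d₁ θ q * (Real.sin (2 * ξ * y) * y)) (by fun_prop)
  have j1 := (mul_density hc hs q m M (Q := fun y => Real.cos (ξ * y)) (by fun_prop)).1
  have j2 := (mul_density hc hs q m M (Q := fun y => Real.sin (ξ * y)) (by fun_prop)).1
  rw [intervalIntegral.integral_add (intervalIntegrable_ofReal (i1.add i2))
      ((intervalIntegrable_ofReal i3).const_mul I),
    intervalIntegral.integral_const_mul, intervalIntegral.integral_ofReal,
    intervalIntegral.integral_ofReal, intervalIntegral.integral_add i1 i2,
    integral_one_sub_corr hc hs q hq hmM hle, integral_cos_density hc hs q hmM hle,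
    integral_sin_density hc hs q hmM hle]
  have e : ∀ y : ℝ, exp (ξ * y * I) * (density θ q m M y : ℂ)
      = ((Real.cos (ξ * y) * density θ q m M y : ℝ) : ℂ)
        + I * ((Real.sin (ξ * y) * density θ q m M y : ℝ) : ℂ) := by
    intro y
    rw [Complex.exp_mul_I]
    push_cast
    ring
  simp only [e]
  have l1 : Integrable fun y => ((Real.cos (ξ * y) * density θ q m M y : ℝ) : ℂ) := j1.ofReal
  have l2 : Integrable fun y => ((Real.sin (ξ * y) * density θ q m M y : ℝ) : ℂ) := j2.ofReal
  rw [integral_add l1 (l2.const_mul I), integral_const_mul, integral_complex_ofReal,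
    integral_complex_ofReal]
  have hpi : (Real.pi : ℂ) ≠ 0 := by simp [Real.pi_ne_zero]
  push_cast
  field_simp
  ring

/-- The total mass is read off at `ξ = 0`, where the folded integrand is the constant `2`. -/
lemma atomMass_add_integral_density {θ : Fin 2 → ℝ} (hc : ∀ i, c θ i ≠ 0) (hs : ∀ i, s θ i ≠ 0)
    (q : Fin 4 → ℂ) (hq : ∑ i, ‖q i‖ ^ 2 = 1) {m M : Fin 2} (hmM : m ≠ M)
    (hle : |c θ m| ≤ |c θ M|) : atomMass θ q + ∫ y, density θ q m M y = 1 := by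
  have h := integral_fold_eq hc hs q hq hmM hle 0
  simp only [tensorForm_phaseMatrix_fold hc q hq] at h
  have hpi : (Real.pi : ℂ) ≠ 0 := by simp [Real.pi_ne_zero]
  simp at h
  norm_num at h
  field_simp at h
  have h2 : (1 : ℝ) + 1 = 2 * (atomMass θ q + ∫ y, density θ q m M y) := by exact_mod_cast h
  linarith

/-- The limit law `Δ δ₀ + f(y) dy`. -/
def limitLaw (θ : Fin 2 → ℝ) (q : Fin 4 → ℂ) (m M : Fin 2) : Measure ℝ :=
  ENNReal.ofReal (atomMass θ q) • Measure.dirac 0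
    + volume.withDensity fun y => ENNReal.ofReal (density θ q m M y)

lemma integrable_density {θ : Fin 2 → ℝ} (hc : ∀ i, c θ i ≠ 0) (hs : ∀ i, s θ i ≠ 0)
    (q : Fin 4 → ℂ) (m M : Fin 2) : Integrable (density θ q m M) := by
  simpa using (mul_density hc hs q m M (Q := fun _ => 1) continuous_const).1

lemma limitLaw_apply {θ : Fin 2 → ℝ} (q : Fin 4 → ℂ) {m M : Fin 2} {A : Set ℝ}
    (hA : MeasurableSet A) :
    limitLaw θ q m M A = ENNReal.ofReal (atomMass θ q) * A.indicator 1 0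
      + ∫⁻ y in A, ENNReal.ofReal (density θ q m M y) := by
  rw [limitLaw, Measure.add_apply, Measure.smul_apply, Measure.dirac_apply' _ hA,
    withDensity_apply _ hA, smul_eq_mul]

lemma isProbabilityMeasure_limitLaw {θ : Fin 2 → ℝ} (hc : ∀ i, c θ i ≠ 0) (hs : ∀ i, s θ i ≠ 0)
    (q : Fin 4 → ℂ) (hq : ∑ i, ‖q i‖ ^ 2 = 1) {m M : Fin 2} (hmM : m ≠ M)
    (hle : |c θ m| ≤ |c θ M|) : IsProbabilityMeasure (limitLaw θ q m M) := by
  refine ⟨?_⟩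
  have h0 := density_nonneg hc hs q hq hmM hle
  rw [limitLaw_apply q MeasurableSet.univ, setLIntegral_univ, ← ofReal_integral_eq_lintegral_ofReal
    (integrable_density hc hs q m M) (Eventually.of_forall h0), Set.indicator_univ, Pi.one_apply,
    mul_one, ← ENNReal.ofReal_add (atomMass_nonneg hc hs q hq hmM hle) (integral_nonneg h0),
    atomMass_add_integral_density hc hs q hq hmM hle, ENNReal.ofReal_one]

lemma limitLaw_real_Iic {θ : Fin 2 → ℝ} (hc : ∀ i, c θ i ≠ 0) (hs : ∀ i, s θ i ≠ 0)
    (q : Fin 4 → ℂ) (hq : ∑ i, ‖q i‖ ^ 2 = 1) {m M : Fin 2} (hmM : m ≠ M)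
    (hle : |c θ m| ≤ |c θ M|) (x : ℝ) :
    (limitLaw θ q m M).real (Set.Iic x)
      = (if 0 ≤ x then atomMass θ q else 0) + ∫ y in Set.Iic x, density θ q m M y := by
  have h0 := density_nonneg hc hs q hq hmM hle
  have hA := atomMass_nonneg hc hs q hq hmM hle
  have hI : 0 ≤ ∫ y in Set.Iic x, density θ q m M y := integral_nonneg h0
  rw [Measure.real, limitLaw_apply q measurableSet_Iic, ← ofReal_integral_eq_lintegral_ofReal
    (integrable_density hc hs q m M).integrableOn (Eventually.of_forall h0)]
  split_ifs with hx
  · rw [Set.indicator_of_mem (by exact hx), Pi.one_apply, mul_one, ← ENNReal.ofReal_add hA hI,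
      ENNReal.toReal_ofReal (add_nonneg hA hI)]
  · rw [Set.indicator_of_notMem (by exact hx), mul_zero, zero_add, zero_add,
      ENNReal.toReal_ofReal hI]

lemma limitLaw_singleton {θ : Fin 2 → ℝ} (q : Fin 4 → ℂ) {m M : Fin 2} {x : ℝ} (hx : x ≠ 0) :
    limitLaw θ q m M {x} = 0 := by
  rw [limitLaw_apply q (measurableSet_singleton x)]
  simp [hx.symm]

lemma charFun_limitLaw {θ : Fin 2 → ℝ} (hc : ∀ i, c θ i ≠ 0) (hs : ∀ i, s θ i ≠ 0)
    (q : Fin 4 → ℂ) (hq : ∑ i, ‖q i‖ ^ 2 = 1) {m M : Fin 2} (hmM : m ≠ M)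
    (hle : |c θ m| ≤ |c θ M|) (ξ : ℝ) : charFun (limitLaw θ q m M) ξ
      = (atomMass θ q : ℂ) + ∫ y : ℝ, exp (ξ * y * I) * (density θ q m M y : ℂ) := by
  have hp := isProbabilityMeasure_limitLaw hc hs q hq hmM hle
  have hint : Integrable (fun y : ℝ => exp (ξ * y * I)) (limitLaw θ q m M) := by
    refine Integrable.of_bound (by fun_prop) 1 (Eventually.of_forall fun y => ?_)
    rw [← Complex.ofReal_mul, Complex.norm_exp_ofReal_mul_I]
  rw [limitLaw, integrable_add_measure] at hint
  rw [charFun_apply_real, limitLaw, integral_add_measure hint.1 hint.2, integral_smul_measure,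
    integral_dirac, integral_withDensity_eq_integral_toReal_smul₀
      (integrable_density hc hs q m M).aemeasurable.ennreal_ofReal (by simp)]
  rw [ENNReal.toReal_ofReal (atomMass_nonneg hc hs q hq hmM hle)]
  simp only [ENNReal.toReal_ofReal (density_nonneg hc hs q hq hmM hle _), Complex.real_smul]
  simp [mul_comm]

lemma tendsto_rescaledCDF {θ : Fin 2 → ℝ} (hc : ∀ i, c θ i ≠ 0) (hs : ∀ i, s θ i ≠ 0)
    (q : Fin 4 → ℂ) (hq : ∑ i, ‖q i‖ ^ 2 = 1) {m M : Fin 2} (hmM : m ≠ M)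
    (hle : |c θ m| ≤ |c θ M|) {x : ℝ} (hx : x ≠ 0) :
    Tendsto (fun t : ℕ => rescaledCDF θ q hq t x) atTop
      (𝓝 ((if 0 ≤ x then atomMass θ q else 0) + ∫ y in Set.Iic x, density θ q m M y)) := by
  have hp := isProbabilityMeasure_limitLaw hc hs q hq hmM hle
  let μs : ℕ → ProbabilityMeasure ℝ := fun t => ⟨rescaledLaw θ q hq t, inferInstance⟩
  let μ : ProbabilityMeasure ℝ := ⟨limitLaw θ q m M, hp⟩
  have hlim : Tendsto μs atTop (𝓝 μ) := by
    rw [ProbabilityMeasure.tendsto_iff_tendsto_charFun]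
    intro ξ
    have h := tendsto_charFun_rescaledLaw θ hc q hq ξ
    rw [integral_fold_eq hc hs q hq hmM hle, ← charFun_limitLaw hc hs q hq hmM hle] at h
    exact h
  have h := ProbabilityMeasure.tendsto_measure_of_null_frontier_of_tendsto' hlim (E := Set.Iic x)
    (by rw [frontier_Iic]; exact limitLaw_singleton q hx)
  have h2 := (ENNReal.tendsto_toReal (measure_ne_top (limitLaw θ q m M) (Set.Iic x))).comp h
  rw [← limitLaw_real_Iic hc hs q hq hmM hle]
  exact h2.congr fun t => (rescaledCDF_eq θ q hq t x).symm

end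

end QWalk

end

theorem theorem2
    (θ : Fin 2 → ℝ)
    (hθ : ∀ i, θ i ∈ Set.Ico 0 (2 * Real.pi))
    (hθ' : ∀ i, θ i ∉ ({0, Real.pi / 2, Real.pi, 3 * Real.pi / 2} : Set ℝ))
    (q : Fin 4 → ℂ) (hq : ∑ i, ‖q i‖ ^ 2 = 1)
    (m M : Fin 2) (hmM : m ≠ M)
    (hm : |QWalk.c θ m| = min |QWalk.c θ 0| |QWalk.c θ 1|)
    (hM : |QWalk.c θ M| = max |QWalk.c θ 0| |QWalk.c θ 1|) :
    0 ≤ QWalk.atomMass θ q ∧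
    (∀ y, 0 ≤ QWalk.density θ q m M y) ∧
    Integrable (QWalk.density θ q m M) ∧
    QWalk.atomMass θ q + ∫ y, QWalk.density θ q m M y = 1 ∧
    ∀ x : ℝ, x ≠ 0 →
      Tendsto (fun t : ℕ => QWalk.rescaledCDF θ q hq t x) atTop
        (𝓝 ((if 0 ≤ x then QWalk.atomMass θ q else 0)
          + ∫ y in Set.Iic x, QWalk.density θ q m M y)) := by
  have hne : ∀ i, θ i ≠ 0 ∧ θ i ≠ Real.pi / 2 ∧ θ i ≠ Real.pi ∧ θ i ≠ 3 * Real.pi / 2 := by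
    intro i
    simpa [not_or] using hθ' i
  have hs : ∀ i, QWalk.s θ i ≠ 0 := by
    intro i h
    obtain ⟨n, hn⟩ := Real.sin_eq_zero_iff.1 h
    obtain ⟨h0, h1⟩ := hθ i
    rw [← hn] at h0 h1
    have hn0 : 0 ≤ n := by
      by_contra hlt
      have : (n : ℝ) ≤ -1 := by exact_mod_cast (by omega : n ≤ -1)
      nlinarith [Real.pi_pos]
    have hn1 : n < 2 := by
      have : (n : ℝ) < 2 := lt_of_mul_lt_mul_right h1 Real.pi_pos.le
      exact_mod_cast this
    interval_cases n
    · exact (hne i).1 (by simpa using hn.symm)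
    · exact (hne i).2.2.1 (by simpa using hn.symm)
  have hc : ∀ i, QWalk.c θ i ≠ 0 := by
    intro i h
    obtain ⟨n, hn⟩ := Real.cos_eq_zero_iff.1 h
    obtain ⟨h0, h1⟩ := hθ i
    rw [hn] at h0 h1
    have hn0 : 0 ≤ n := by
      by_contra hlt
      have : (n : ℝ) ≤ -1 := by exact_mod_cast (by omega : n ≤ -1)
      nlinarith [Real.pi_pos]
    have hn1 : n < 2 := by
      have : (n : ℝ) < 2 := by nlinarith [Real.pi_pos]
      exact_mod_cast this
    interval_cases n
    · exact (hne i).2.1 (by rw [hn]; push_cast; ring)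
    · exact (hne i).2.2.2 (by rw [hn]; push_cast; ring)
  have hle : |QWalk.c θ m| ≤ |QWalk.c θ M| := by
    rw [hm, hM]; exact min_le_max
  exact ⟨QWalk.atomMass_nonneg hc hs q hq hmM hle, QWalk.density_nonneg hc hs q hq hmM hle,
    QWalk.integrable_density hc hs q m M,
    QWalk.atomMass_add_integral_density hc hs q hq hmM hle,
    fun x hx => QWalk.tendsto_rescaledCDF hc hs q hq hmM hle hx⟩
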